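/- Let $V$ be a Möbius or conformal vertex algebra over $\mathbb{C}$ (a $\mathbb{Z}$-graded vertex algebra with, respectively, a compatible $\mathfrak{sl}(2)$-action by operators $L(-1),L(0),L(1)$, or a conformal vector $\omega$ with $L(n)=\omega_{n+1}$; no grading restrictions are imposed). Let $W_1,W_2,W_3$ be generalized $V$-modules, i.e. modules in which $L(0)$ need not be semisimple and which are the direct sums $W=\coprod_{n\in\mathbb{C}}W_{[n]}$ of the generalized eigenspaces of $L(0)$; write $Y_i$ for the vertex operator map of $W_i$. A *logarithmic intertwining operator of type* $\binom{W_3}{W_1W_2}$ is a linear map $$\mathcal{Y}(\cdot,x)\cdot:W_1\otimes W_2\to W_3[\log x]\{x\},\qquad w_{(1)}\otimes w_{(2)}\mapsto\sum_{n\in\mathbb{C}}\sum_{k\in\mathbb{N}}w_{(1)}{}^{\mathcal{Y}}_{n;k}w_{(2)}\,x^{-n-1}(\log x)^k$$ (for each $n$ only finitely many $k$ contribute) such that for all $v\in V$, $w_{(1)}\in W_1$, $w_{(2)}\in W_2$: (i) for each $n\in\mathbb{C}$, $w_{(1)}{}^{\mathcal{Y}}_{n+m;k}w_{(2)}=0$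 for $m\in\mathbb{N}$ sufficiently large, independently of $k$; (ii) the Jacobi identity holds: $$x_0^{-1}\delta\Big(\frac{x_1-x_2}{x_0}\Big)Y_3(v,x_1)\mathcal{Y}(w_{(1)},x_2)w_{(2)}-x_0^{-1}\delta\Big(\frac{x_2-x_1}{-x_0}\Big)\mathcal{Y}(w_{(1)},x_2)Y_2(v,x_1)w_{(2)}=x_2^{-1}\delta\Big(\frac{x_1-x_0}{x_2}\Big)\mathcal{Y}(Y_1(v,x_0)w_{(1)},x_2)w_{(2)};$$ (iii) $\mathcal{Y}(L(-1)w_{(1)},x)=\frac{d}{dx}\mathcal{Y}(w_{(1)},x)$; (iv) $[L(j),\mathcal{Y}(w_{(1)},x)]=\sum_{i=0}^{j+1}\binom{j+1}{i}x^i\mathcal{Y}(L(j-i)w_{(1)},x)$ for $j=-1,0,1$. (Here $\log x$ is a formal variable with $\frac{d}{dx}\log x=x^{-1}$.) For $r\in\mathbb{Z}$ and a linear map $\mathcal{Y}:W_1\otimes W_2\to W_3[\log x]\{x\}$ satisfying (i), define $\Omega_r(\mathcal{Y}):W_2\otimes W_1\to W_3[\log x]\{x\}$ by $$\Omega_r(\mathcal{Y})(w_{(2)},x)w_{(1)}=e^{xL(-1)}\mathcal{Y}(w_{(1)},e^{(2r+1)\pi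 i}x)w_{(2)},$$ where $e^{\zeta}x$ is substituted for the variable by $x^n\mapsto e^{\zeta n}x^n$ and $(\log x)^k\mapsto(\zeta+\log x)^k$ for $n\in\mathbb{C}$, $k\in\mathbb{N}$, with $\zeta=(2r+1)\pi i$; $\Omega_r$ is defined in the same way on maps from $W_2\otimes W_1$. **Proposition.** Let $r\in\mathbb{Z}$. If $\mathcal{Y}$ is a logarithmic intertwining operator of type $\binom{W_3}{W_1W_2}$, then $\Omega_r(\mathcal{Y})$ is a logarithmic intertwining operator of type $\binom{W_3}{W_2W_1}$, and $$\Omega_{-r-1}(\Omega_r(\mathcal{Y}))=\Omega_r(\Omega_{-r-1}(\mathcal{Y}))=\mathcal{Y}.$$ Suppose in addition that $A$ is a subgroup of an abelian group $\tilde A$, that $V$ is strongly $A$-graded and that $W_1,W_2,W_3$ are strongly $\tilde A$-graded. That is, $V=\coprod_{\alpha\in A}V^{(\alpha)}$ and $W_i=\coprod_{\beta\in\tilde A}W_i^{(\beta)}$ are second gradings that are compatible with the gradings by weight; the doubly homogeneous subspaces are finite-dimensional; $V^{(\alpha)}_{(n)}=0$ for $n\in\mathbb{Z}$ sufficiently negative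 and, for each $n\in\mathbb{C}$, $(W_i)^{(\beta)}_{[n+k]}=0$ for $k\in\mathbb{Z}$ sufficiently negative; the vacuum (and $\omega$, in the conformal case) lies in $V^{(0)}$; the components of the vertex operators of elements of $V^{(\alpha)}$ shift the second degree by $\alpha$; and $L(j)$, $j=-1,0,1$, preserves it. Call $\mathcal{Y}$ *grading-compatible* if $w_{(1)}{}^{\mathcal{Y}}_{n;k}w_{(2)}\in W_3^{(\beta+\gamma)}$ for all $w_{(1)}\in W_1^{(\beta)}$, $w_{(2)}\in W_2^{(\gamma)}$, $n\in\mathbb{C}$, $k\in\mathbb{N}$. Let $\mathcal{V}_{W_1W_2}^{W_3}$ be the vector space of grading-compatible logarithmic intertwining operators of type $\binom{W_3}{W_1W_2}$ and $N_{W_1W_2}^{W_3}$ its dimension. If $\mathcal{Y}$ is grading-compatible, then so is $\Omega_r(\mathcal{Y})$; the correspondence $\mathcal{Y}\mapsto\Omega_r(\mathcal{Y})$ defines a linear isomorphism from $\mathcal{V}_{W_1W_2}^{W_3}$ to $\mathcal{V}_{W_2W_1}^{W_3}$; and $$N_{W_1W_2}^{W_3}=N_{W_2W_1}^{W_3}.$$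 -/

import Mathlib

open scoped Nat

noncomputable section

namespace LogVA

/-! ## Formal series, and the identities shared by all the structures -/

/-- The space `W[log x]{x}` of formal series `∑ w_{n,k} x^n (log x)^k` with `n ∈ ℂ`, `k ∈ ℕ`, where
for each `n` only finitely many `w_{n,k}` are nonzero. `f n k` is the coefficient of
`x^n (log x)^k`. -/
abbrev LogSeries (W : Type*) [AddCommGroup W] : Type _ := ℂ → ℕ →₀ W

/-- `p` gives a direct sum decomposition `W = ∐ i, p i`. -/
def IsDirectSumDecomposition {ι W : Type*} [AddCommGroup W] [Module ℂ W]
    (p : ι → Submodule ℂ W) : Prop :=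
  iSupIndep p ∧ ⨆ i, p i = ⊤

/-- Three operators `L(-1)`, `L(0)`, `L(1)` on a space. -/
structure SL2Operators (W : Type*) [AddCommGroup W] [Module ℂ W] where
  /-- the operator `L(-1)` -/
  neg : Module.End ℂ W
  /-- the operator `L(0)` -/
  zero : Module.End ℂ W
  /-- the operator `L(1)` -/
  pos : Module.End ℂ W

/-- The operators `L(-1)`, `L(0)`, `L(1)` define a representation of `𝔰𝔩(2)`:
`[L(0), L(-1)] = L(-1)`, `[L(0), L(1)] = -L(1)`, `[L(-1), L(1)] = -2 L(0)`. -/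
structure SL2Operators.IsRepresentation {W : Type*} [AddCommGroup W] [Module ℂ W]
    (L : SL2Operators W) : Prop where
  zero_neg : L.zero * L.neg - L.neg * L.zero = L.neg
  zero_pos : L.zero * L.pos - L.pos * L.zero = -L.pos
  neg_pos : L.neg * L.pos - L.pos * L.neg = (-2 : ℂ) • L.zero

section Identities

variable {V W₁ W₂ W₃ E : Type*} [AddCommGroup V] [Module ℂ V]
  [AddCommGroup W₁] [Module ℂ W₁] [AddCommGroup W₂] [Module ℂ W₂]
  [AddCommGroup W₃] [Module ℂ W₃] [Ring E]

/-- The coefficient of `x₀^(-l-1) x₁^(-m-1) x₂^(-n-1)` in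
`x₀⁻¹ δ((x₁ - x₂)/x₀) Y₃(v, x₁) I(w₁, x₂) w₂`, where
`x₀⁻¹ δ((x₁ - x₂)/x₀) = ∑_{l ∈ ℤ, i ∈ ℕ} (-1)^i (l choose i) x₀^(-l-1) x₁^(l-i) x₂^i`,
`Y₃(v, x) = ∑_{n ∈ ℤ} v_n x^(-n-1)` with `Y₃ v w n = v_n w`, and
`I(w₁, x) w₂ = ∑_n (I w₁ w₂ n) x^(-n-1)`, the exponents running over `ℤ` or `ℂ`. -/
def jacobiFirst (Y₃ : V →ₗ[ℂ] W₃ →ₗ[ℂ] (ℤ → W₃)) (I : W₁ → W₂ → E → W₃)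
    (v : V) (w₁ : W₁) (w₂ : W₂) (l m : ℤ) (n : E) : W₃ :=
  ∑ᶠ i : ℕ, ((-1) ^ i * Ring.choose l i : ℤ) • Y₃ v (I w₁ w₂ (n + (i : E))) (l + m - (i : ℤ))

/-- The coefficient of `x₀^(-l-1) x₁^(-m-1) x₂^(-n-1)` in
`x₀⁻¹ δ((x₂ - x₁)/(-x₀)) I(w₁, x₂) Y₂(v, x₁) w₂`, where
`x₀⁻¹ δ((x₂ - x₁)/(-x₀)) = ∑_{l ∈ ℤ, i ∈ ℕ} (-1)^(l+i) (l choose i) x₀^(-l-1) x₂^(l-i) x₁^i`. -/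
def jacobiSecond (Y₂ : V →ₗ[ℂ] W₂ →ₗ[ℂ] (ℤ → W₂)) (I : W₁ → W₂ → E → W₃)
    (v : V) (w₁ : W₁) (w₂ : W₂) (l m : ℤ) (n : E) : W₃ :=
  ∑ᶠ i : ℕ, ((l.negOnePow : ℤ) * (-1) ^ i * Ring.choose l i : ℤ) •
    I w₁ (Y₂ v w₂ (m + (i : ℤ))) (n + (l : E) - (i : E))

/-- The coefficient of `x₀^(-l-1) x₁^(-m-1) x₂^(-n-1)` in
`x₂⁻¹ δ((x₁ - x₀)/x₂) I(Y₁(v, x₀) w₁, x₂) w₂`, where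
`x₂⁻¹ δ((x₁ - x₀)/x₂) = ∑_{m ∈ ℤ, i ∈ ℕ} (m choose i) x₁^(-m-1) x₂^(m-i) x₀^i`
(for `i - m - 1` in place of the exponent of `x₁ - x₀` one has
`(-1)^i (i-m-1 choose i) = (m choose i)`). -/
def jacobiThird (Y₁ : V →ₗ[ℂ] W₁ →ₗ[ℂ] (ℤ → W₁)) (I : W₁ → W₂ → E → W₃)
    (v : V) (w₁ : W₁) (w₂ : W₂) (l m : ℤ) (n : E) : W₃ :=
  ∑ᶠ i : ℕ, (Ring.choose m i : ℤ) •
    I (Y₁ v w₁ (l + (i : ℤ))) w₂ ((m : E) + n - (i : E))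

/-- The Jacobi identity
`x₀⁻¹ δ((x₁ - x₂)/x₀) Y₃(v, x₁) I(w₁, x₂) w₂ - x₀⁻¹ δ((x₂ - x₁)/(-x₀)) I(w₁, x₂) Y₂(v, x₁) w₂`
`= x₂⁻¹ δ((x₁ - x₀)/x₂) I(Y₁(v, x₀) w₁, x₂) w₂`, as an equality of the coefficients of all the
monomials. It is only used for `Y₁`, `Y₂` and `I` that are lower truncated, so that the sums defining
the coefficients are finite. -/
def JacobiIdentity (Y₁ : V →ₗ[ℂ] W₁ →ₗ[ℂ] (ℤ → W₁)) (Y₂ : V →ₗ[ℂ] W₂ →ₗ[ℂ] (ℤ → W₂))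
    (Y₃ : V →ₗ[ℂ] W₃ →ₗ[ℂ] (ℤ → W₃)) (I : W₁ → W₂ → E → W₃) : Prop :=
  ∀ (v : V) (w₁ : W₁) (w₂ : W₂) (l m : ℤ) (n : E),
    jacobiFirst Y₃ I v w₁ w₂ l m n - jacobiSecond Y₂ I v w₁ w₂ l m n
      = jacobiThird Y₁ I v w₁ w₂ l m n

/-- The `𝔰𝔩(2)`-bracket relations
`[L(j), I(w₁, x)] = ∑_{i=0}^{j+1} (j+1 choose i) x^i I(L(j-i) w₁, x)` for `j = -1, 0, 1`,
applied to `w₂`; here `I(w₁, x) w₂ = ∑_n (I w₁ w₂ n) x^(-n-1)` and the coefficients of `x^(-n-1)`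
are compared. -/
structure SL2BracketRelations (L₁ : SL2Operators W₁) (L₂ : SL2Operators W₂)
    (L₃ : SL2Operators W₃) (I : W₁ → W₂ → E → W₃) : Prop where
  neg : ∀ w₁ w₂ n, L₃.neg (I w₁ w₂ n) - I w₁ (L₂.neg w₂) n = I (L₁.neg w₁) w₂ n
  zero : ∀ w₁ w₂ n, L₃.zero (I w₁ w₂ n) - I w₁ (L₂.zero w₂) n
    = I (L₁.zero w₁) w₂ n + I (L₁.neg w₁) w₂ (n + 1)
  pos : ∀ w₁ w₂ n, L₃.pos (I w₁ w₂ n) - I w₁ (L₂.pos w₂) n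
    = I (L₁.pos w₁) w₂ n + (2 : ℂ) • I (L₁.zero w₁) w₂ (n + 1) + I (L₁.neg w₁) w₂ (n + 2)

/-- The component `v_n` of `Y(v, x) = ∑ v_n x^(-n-1)`, as an operator. -/
def component (Y : V →ₗ[ℂ] W₁ →ₗ[ℂ] (ℤ → W₁)) (v : V) (n : ℤ) : Module.End ℂ W₁ :=
  LinearMap.proj n ∘ₗ Y v

/-- The Virasoro algebra relations with scalar `c` for a sequence of operators:
`[L(m), L(n)] = (m - n) L(m + n) + (1/12)(m³ - m) δ_{m+n,0} c`. -/
def VirasoroRelations (L : ℤ → Module.End ℂ W₁) (c : ℂ) : Prop :=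
  ∀ m n : ℤ, L m * L n - L n * L m = ((m : ℂ) - n) • L (m + n)
    + (if m + n = 0 then ((m : ℂ) ^ 3 - m) / 12 * c else 0) • (1 : Module.End ℂ W₁)

end Identities

/-! ## Möbius and conformal vertex algebras -/

/-- A `ℤ`-graded vertex algebra: the data and axioms common to Möbius and conformal vertex algebras.
`Y u v n` is `u_n v`, the coefficient of `x^(-n-1)` in `Y(u, x) v`. -/
structure GradedVertexAlgebra (V : Type*) [AddCommGroup V] [Module ℂ V] where
  /-- the homogeneous subspaces `V_(n)` -/
  grading : ℤ → Submodule ℂ V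
  decomposition : IsDirectSumDecomposition grading
  /-- the vertex operator map -/
  Y : V →ₗ[ℂ] V →ₗ[ℂ] (ℤ → V)
  /-- the vacuum vector -/
  vac : V
  vac_mem : vac ∈ grading 0
  truncation : ∀ u v, ∃ N : ℤ, ∀ n ≥ N, Y u v n = 0
  vacuum : ∀ v n, Y vac v n = if n = -1 then v else 0
  creation : ∀ v, (∀ n ≥ 0, Y v vac n = 0) ∧ Y v vac (-1) = v
  jacobi : JacobiIdentity Y Y Y (fun u v n => Y u v n)

/-- A Möbius vertex algebra. -/
structure MobiusVertexAlgebra (V : Type*) [AddCommGroup V] [Module ℂ V]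
    extends GradedVertexAlgebra V where
  /-- the operators `L(-1)`, `L(0)`, `L(1)` -/
  L : SL2Operators V
  isRepresentation : L.IsRepresentation
  bracket : SL2BracketRelations L L L (fun u v n => Y u v n)
  /-- `(d/dx) Y(u, x) = Y(L(-1) u, x)` -/
  derivative : ∀ u v n, Y (L.neg u) v n = (-n : ℂ) • Y u v (n - 1)
  weight : ∀ (n : ℤ), ∀ v ∈ grading n, L.zero v = (n : ℂ) • v

/-- A conformal vertex algebra; `L(n) = ω_{n+1}`. -/
structure ConformalVertexAlgebra (V : Type*) [AddCommGroup V] [Module ℂ V]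
    extends GradedVertexAlgebra V where
  /-- the conformal vector -/
  ω : V
  omega_mem : ω ∈ grading 2
  /-- the central charge -/
  c : ℂ
  virasoro : VirasoroRelations (fun n => component Y ω (n + 1)) c
  /-- `(d/dx) Y(u, x) = Y(L(-1) u, x)` -/
  derivative : ∀ u v n, Y (component Y ω 0 u) v n = (-n : ℂ) • Y u v (n - 1)
  weight : ∀ (n : ℤ), ∀ v ∈ grading n, component Y ω 1 v = (n : ℂ) • v

/-- A Möbius or conformal vertex algebra. -/
inductive VertexAlgebra (V : Type*) [AddCommGroup V] [Module ℂ V] where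
  | mobius (𝒱 : MobiusVertexAlgebra V)
  | conformal (𝒱 : ConformalVertexAlgebra V)

/-! ## Generalized modules -/

/-- The data and axioms for the vertex operator map of a module that do not involve `L(j)`.
`Y v w n` is `v_n w`, the coefficient of `x^(-n-1)` in `Y(v, x) w`. -/
structure VertexModule {V : Type*} [AddCommGroup V] [Module ℂ V] (𝒱 : GradedVertexAlgebra V)
    (W : Type*) [AddCommGroup W] [Module ℂ W] where
  /-- the vertex operator map of the module -/
  Y : V →ₗ[ℂ] W →ₗ[ℂ] (ℤ → W)
  truncation : ∀ v w, ∃ N : ℤ, ∀ n ≥ N, Y v w n = 0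
  vacuum : ∀ w n, Y 𝒱.vac w n = if n = -1 then w else 0
  jacobi : JacobiIdentity 𝒱.Y Y Y (fun v w n => Y v w n)

/-- A generalized module for a Möbius vertex algebra; it is the direct sum of the generalized
eigenspaces `W_[n]`, `n ∈ ℂ`, of `L(0)`. -/
structure MobiusVertexAlgebra.GeneralizedModule {V : Type*} [AddCommGroup V] [Module ℂ V]
    (𝒱 : MobiusVertexAlgebra V) (W : Type*) [AddCommGroup W] [Module ℂ W]
    extends VertexModule 𝒱.toGradedVertexAlgebra W where
  /-- the operators `L(-1)`, `L(0)`, `L(1)` on the module -/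
  L : SL2Operators W
  isRepresentation : L.IsRepresentation
  bracket : SL2BracketRelations 𝒱.L L L (fun v w n => Y v w n)
  derivative : ∀ v w n, Y (𝒱.L.neg v) w n = (-n : ℂ) • Y v w (n - 1)
  decomposition : IsDirectSumDecomposition fun n : ℂ => L.zero.maxGenEigenspace n

/-- A generalized module for a conformal vertex algebra; `L(n) = ω_{n+1}` on the module, and the
module is the direct sum of the generalized eigenspaces `W_[n]`, `n ∈ ℂ`, of `L(0)`. -/
structure ConformalVertexAlgebra.GeneralizedModule {V : Type*} [AddCommGroup V] [Module ℂ V]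
    (𝒱 : ConformalVertexAlgebra V) (W : Type*) [AddCommGroup W] [Module ℂ W]
    extends VertexModule 𝒱.toGradedVertexAlgebra W where
  virasoro : VirasoroRelations (fun n => component Y 𝒱.ω (n + 1)) 𝒱.c
  derivative : ∀ v w n, Y (component 𝒱.Y 𝒱.ω 0 v) w n = (-n : ℂ) • Y v w (n - 1)
  decomposition : IsDirectSumDecomposition fun n : ℂ => (component Y 𝒱.ω 1).maxGenEigenspace n

namespace VertexAlgebra

variable {V : Type*} [AddCommGroup V] [Module ℂ V]

/-- The underlying graded vertex algebra. -/
def graded : VertexAlgebra V → GradedVertexAlgebra V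
  | .mobius 𝒱 => 𝒱.toGradedVertexAlgebra
  | .conformal 𝒱 => 𝒱.toGradedVertexAlgebra

/-- The operators `L(-1)`, `L(0)`, `L(1)` on the algebra. -/
def L : VertexAlgebra V → SL2Operators V
  | .mobius 𝒱 => 𝒱.L
  | .conformal 𝒱 => ⟨component 𝒱.Y 𝒱.ω 0, component 𝒱.Y 𝒱.ω 1, component 𝒱.Y 𝒱.ω 2⟩

/-- A generalized module for a Möbius or conformal vertex algebra. -/
def GeneralizedModule (𝒱 : VertexAlgebra V) (W : Type*) [AddCommGroup W] [Module ℂ W] : Type _ :=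
  match 𝒱 with
  | .mobius 𝒱 => 𝒱.GeneralizedModule W
  | .conformal 𝒱 => 𝒱.GeneralizedModule W

namespace GeneralizedModule

variable {W : Type*} [AddCommGroup W] [Module ℂ W]

/-- The vertex operator map of a generalized module. -/
def Y {𝒱 : VertexAlgebra V} (M : 𝒱.GeneralizedModule W) : V →ₗ[ℂ] W →ₗ[ℂ] (ℤ → W) :=
  match 𝒱, M with
  | .mobius _, M => MobiusVertexAlgebra.GeneralizedModule.toVertexModule M |>.Y
  | .conformal _, M => ConformalVertexAlgebra.GeneralizedModule.toVertexModule M |>.Y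

/-- The operators `L(-1)`, `L(0)`, `L(1)` on a generalized module. -/
def L {𝒱 : VertexAlgebra V} (M : 𝒱.GeneralizedModule W) : SL2Operators W :=
  match 𝒱, M with
  | .mobius _, M => MobiusVertexAlgebra.GeneralizedModule.L M
  | .conformal 𝒱, M =>
    let Y := (ConformalVertexAlgebra.GeneralizedModule.toVertexModule M).Y
    ⟨component Y 𝒱.ω 0, component Y 𝒱.ω 1, component Y 𝒱.ω 2⟩

/-- The generalized weight space `W_[n]`. -/
def weightSpace {𝒱 : VertexAlgebra V} (M : 𝒱.GeneralizedModule W) (n : ℂ) : Submodule ℂ W :=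
  M.L.zero.maxGenEigenspace n

/-- Lower truncation of the vertex operator map, in both cases. -/
theorem truncation {𝒱 : VertexAlgebra V} (M : 𝒱.GeneralizedModule W) (v : V) (w : W) :
    ∃ N : ℤ, ∀ n ≥ N, M.Y v w n = 0 := by
  cases 𝒱 with
  | mobius 𝒱 => exact (MobiusVertexAlgebra.GeneralizedModule.toVertexModule M).truncation v w
  | conformal 𝒱 => exact (ConformalVertexAlgebra.GeneralizedModule.toVertexModule M).truncation v w

end GeneralizedModule

/-! ## Strong gradings -/

/-- A strong grading of a Möbius or conformal vertex algebra by an abelian group `A`. -/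
structure StrongGrading (𝒱 : VertexAlgebra V) (A : Type*) [AddCommGroup A] where
  /-- the homogeneous subspaces `V^(α)` -/
  space : A → Submodule ℂ V
  decomposition : IsDirectSumDecomposition space
  compatible : ∀ α, space α = ⨆ n : ℤ, 𝒱.graded.grading n ⊓ space α
  bounded : ∀ α, ∃ N : ℤ, ∀ n ≤ N, 𝒱.graded.grading n ⊓ space α = ⊥
  finite : ∀ α n, FiniteDimensional ℂ ↥(𝒱.graded.grading n ⊓ space α)
  vac_mem : 𝒱.graded.vac ∈ space 0
  component_mem : ∀ α β, ∀ v ∈ space α, ∀ u ∈ space β, ∀ l, 𝒱.graded.Y v u l ∈ space (α + β)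
  L_mem : ∀ α, ∀ v ∈ space α,
    𝒱.L.neg v ∈ space α ∧ 𝒱.L.zero v ∈ space α ∧ 𝒱.L.pos v ∈ space α
  omega_mem : ∀ 𝒞 : ConformalVertexAlgebra V, 𝒱 = .conformal 𝒞 → 𝒞.ω ∈ space 0

/-- A strong grading of a generalized module by an abelian group `B` that contains the grading group
`A` of the algebra as a subgroup. -/
structure GeneralizedModule.StrongGrading {𝒱 : VertexAlgebra V} {B : Type*} [AddCommGroup B]
    {A : AddSubgroup B} (G : 𝒱.StrongGrading A) {W : Type*} [AddCommGroup W] [Module ℂ W]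
    (M : 𝒱.GeneralizedModule W) where
  /-- the homogeneous subspaces `W^(β)` -/
  space : B → Submodule ℂ W
  decomposition : IsDirectSumDecomposition space
  compatible : ∀ β, space β = ⨆ n : ℂ, M.weightSpace n ⊓ space β
  bounded : ∀ β, ∀ n : ℂ, ∃ K : ℤ, ∀ k ≤ K, M.weightSpace (n + (k : ℂ)) ⊓ space β = ⊥
  finite : ∀ β n, FiniteDimensional ℂ ↥(M.weightSpace n ⊓ space β)
  component_mem : ∀ (α : A) (β : B), ∀ v ∈ G.space α, ∀ w ∈ space β, ∀ l,
    M.Y v w l ∈ space ((α : B) + β)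
  L_mem : ∀ β, ∀ w ∈ space β,
    M.L.neg w ∈ space β ∧ M.L.zero w ∈ space β ∧ M.L.pos w ∈ space β

end VertexAlgebra

/-! ## Operations on logarithmic formal series -/

/-- The lower truncation condition: for each `n ∈ ℂ`, no nonzero term `x^(n-m) (log x)^k` appears
when `m ∈ ℕ` is large, independently of `k`. -/
def LowerTruncated {W : Type*} [AddCommGroup W] (f : LogSeries W) : Prop :=
  ∀ n : ℂ, ∃ M : ℕ, ∀ m : ℕ, M ≤ m → f (n - m) = 0

theorem LowerTruncated.add {W : Type*} [AddCommGroup W] {f g : LogSeries W} (hf : LowerTruncated f) (hg : LowerTruncated g) :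
    LowerTruncated (f + g) := by
  intro n
  obtain ⟨M, hM⟩ := hf n
  obtain ⟨N, hN⟩ := hg n
  refine ⟨max M N, fun m hm => ?_⟩
  rw [Pi.add_apply, hM m (le_of_max_le_left hm), hN m (le_of_max_le_right hm), add_zero]

section Series

variable {W : Type*} [AddCommGroup W] [Module ℂ W]

/-- The coefficient of `x^n (log x)^k` in `(d/dx) f`, where
`(d/dx) (x^n (log x)^k) = n x^(n-1) (log x)^k + k x^(n-1) (log x)^(k-1)`. -/
def derivCoeff (f : LogSeries W) (n : ℂ) (k : ℕ) : W :=
  (n + 1) • f (n + 1) k + ((k : ℂ) + 1) • f (n + 1) (k + 1)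

/-- The substitution `f(x) ↦ f(e^ζ x)`, that is `x^n ↦ e^(ζ n) x^n`,
`(log x)^k ↦ (ζ + log x)^k = ∑_j (k choose j) ζ^(k-j) (log x)^j`. -/
def substExp (ζ : ℂ) : LogSeries W →ₗ[ℂ] LogSeries W :=
  LinearMap.pi fun n => Complex.exp (ζ * n) •
    ((Finsupp.lsum ℂ fun k : ℕ => ∑ j ∈ Finset.range (k + 1),
      ((k.choose j : ℂ) * ζ ^ (k - j)) • (Finsupp.lsingle j : W →ₗ[ℂ] ℕ →₀ W)) ∘ₗ
        LinearMap.proj n)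

/-- The product `e^(xT) f(x) = ∑_{i ∈ ℕ} (x^i / i!) T^i f(x)`, for an operator `T`. Each coefficient is
a finite sum when `f` is lower truncated. -/
def expMul (T : Module.End ℂ W) (f : LogSeries W) : LogSeries W := fun n =>
  ∑ᶠ i : ℕ, ((i ! : ℂ)⁻¹) • Finsupp.mapRange.linearMap (T ^ i) (f (n - (i : ℂ)))

theorem LowerTruncated.map {f : LogSeries W} (hf : LowerTruncated f) (ζ : ℂ) :
    LowerTruncated (substExp ζ f) := by
  intro n
  obtain ⟨M, hM⟩ := hf n
  exact ⟨M, fun m hm => by simp [substExp, hM m hm]⟩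

theorem LowerTruncated.expMul {f : LogSeries W} (hf : LowerTruncated f) (T : Module.End ℂ W) :
    LowerTruncated (expMul T f) := by
  intro n
  obtain ⟨M, hM⟩ := hf n
  refine ⟨M, fun m hm => finsum_eq_zero_of_forall_eq_zero fun i => ?_⟩
  have h := hM (m + i) (by omega)
  rw [Nat.cast_add, ← sub_sub] at h
  rw [h, map_zero, smul_zero]

theorem expMul_add (T : Module.End ℂ W) {f g : LogSeries W} (hf : LowerTruncated f)
    (hg : LowerTruncated g) : expMul T (f + g) = expMul T f + expMul T g := by
  have key : ∀ {h : LogSeries W}, LowerTruncated h → ∀ n : ℂ, (Function.support fun i : ℕ =>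
      ((i ! : ℂ)⁻¹) • Finsupp.mapRange.linearMap (T ^ i) (h (n - (i : ℂ)))).Finite := by
    intro h hh n
    obtain ⟨M, hM⟩ := hh n
    refine (Set.finite_lt_nat M).subset fun i hi => ?_
    by_contra hlt
    exact hi (by simp only [hM i (not_lt.mp hlt), map_zero, smul_zero])
  funext n
  simp only [expMul, Pi.add_apply, map_add, smul_add]
  exact finsum_add_distrib (key hf n) (key hg n)

theorem expMul_smul (T : Module.End ℂ W) (a : ℂ) (f : LogSeries W) :
    expMul T (a • f) = a • expMul T f := by
  funext n
  simp only [expMul, Pi.smul_apply, map_smul, smul_finsum]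
  exact finsum_congr fun i => smul_comm _ _ _

end Series

/-! ## Logarithmic intertwining operators -/

section Intertwining

variable {V W₁ W₂ W₃ : Type*} [AddCommGroup V] [Module ℂ V]
  [AddCommGroup W₁] [Module ℂ W₁] [AddCommGroup W₂] [Module ℂ W₂] [AddCommGroup W₃] [Module ℂ W₃]

variable (W₁ W₂ W₃) in
/-- The bilinear maps `𝒴(·, x)· : W₁ ⊗ W₂ → W₃[log x]{x}` satisfying the lower truncation
condition. -/
def TruncatedMap : Submodule ℂ (W₁ →ₗ[ℂ] W₂ →ₗ[ℂ] LogSeries W₃) where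
  carrier := {𝒴 | ∀ w₁ w₂, LowerTruncated (𝒴 w₁ w₂)}
  add_mem' h₁ h₂ w₁ w₂ := (h₁ w₁ w₂).add (h₂ w₁ w₂)
  zero_mem' _ _ _ := ⟨0, fun _ _ => rfl⟩
  smul_mem' a 𝒴 h w₁ w₂ n := by
    obtain ⟨M, hM⟩ := h w₁ w₂ n
    exact ⟨M, fun m hm => by simp [hM m hm]⟩

/-- The element `w₁_{n;k} w₂` of `W₃`: the coefficient of `x^(-n-1) (log x)^k` in `𝒴(w₁, x) w₂`. -/
def mode (𝒴 : W₁ →ₗ[ℂ] W₂ →ₗ[ℂ] LogSeries W₃) (k : ℕ) (w₁ : W₁) (w₂ : W₂) (n : ℂ) : W₃ :=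
  𝒴 w₁ w₂ (-n - 1) k

variable {𝒱 : VertexAlgebra V}

/-- Logarithmic intertwining operators of type `(W₃; W₁ W₂)`. -/
structure IsLogIntertwiningOperator (M₁ : 𝒱.GeneralizedModule W₁) (M₂ : 𝒱.GeneralizedModule W₂)
    (M₃ : 𝒱.GeneralizedModule W₃) (𝒴 : TruncatedMap W₁ W₂ W₃) : Prop where
  jacobi : ∀ k, JacobiIdentity M₁.Y M₂.Y M₃.Y (mode 𝒴.1 k)
  /-- `𝒴(L(-1) w₁, x) = (d/dx) 𝒴(w₁, x)` -/
  derivative : ∀ w₁ w₂ n k, 𝒴.1 (M₁.L.neg w₁) w₂ n k = derivCoeff (𝒴.1 w₁ w₂) n k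
  bracket : ∀ k, SL2BracketRelations M₁.L M₂.L M₃.L (mode 𝒴.1 k)

theorem finite_support_of_bound {M : Type*} [Zero M] {f : ℕ → M}
    (h : ∃ N : ℕ, ∀ i : ℕ, N ≤ i → f i = 0) : (Function.support f).Finite := by
  obtain ⟨N, hN⟩ := h
  refine (Set.finite_lt_nat N).subset fun i hi => ?_
  by_contra hlt
  exact hi (hN i (not_lt.mp hlt))

theorem first_finite (M₃ : 𝒱.GeneralizedModule W₃) (𝒴 : TruncatedMap W₁ W₂ W₃) (k : ℕ)
    (v : V) (w₁ : W₁) (w₂ : W₂) (l m : ℤ) (n : ℂ) :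
    (Function.support fun i : ℕ => ((-1) ^ i * Ring.choose l i : ℤ) •
      M₃.Y v (mode 𝒴.1 k w₁ w₂ (n + (i : ℂ))) (l + m - (i : ℤ))).Finite := by
  obtain ⟨N, hN⟩ := 𝒴.2 w₁ w₂ (-n - 1)
  refine finite_support_of_bound ⟨N, fun i hi => ?_⟩
  have h : mode 𝒴.1 k w₁ w₂ (n + (i : ℂ)) = 0 := by
    have e : -(n + (i : ℂ)) - 1 = -n - 1 - i := by ring
    rw [mode, e, hN i hi, Finsupp.zero_apply]
  rw [h, map_zero, Pi.zero_apply, smul_zero]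

theorem nat_bound {M : Type*} [Zero M] {f : ℤ → M} (h : ∃ N : ℤ, ∀ n ≥ N, f n = 0) (m : ℤ) :
    ∃ N : ℕ, ∀ i : ℕ, N ≤ i → f (m + (i : ℤ)) = 0 := by
  obtain ⟨N, hN⟩ := h
  exact ⟨(N - m).toNat, fun i hi => hN _ (by omega)⟩

theorem second_finite (M₂ : 𝒱.GeneralizedModule W₂) (𝒴 : TruncatedMap W₁ W₂ W₃) (k : ℕ)
    (v : V) (w₁ : W₁) (w₂ : W₂) (l m : ℤ) (n : ℂ) :
    (Function.support fun i : ℕ => ((l.negOnePow : ℤ) * (-1) ^ i * Ring.choose l i : ℤ) •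
      mode 𝒴.1 k w₁ (M₂.Y v w₂ (m + (i : ℤ))) (n + (l : ℂ) - (i : ℂ))).Finite := by
  obtain ⟨N, hN⟩ := nat_bound (M₂.truncation v w₂) m
  refine finite_support_of_bound ⟨N, fun i hi => ?_⟩
  rw [hN i hi, mode, map_zero, Pi.zero_apply, Finsupp.zero_apply, smul_zero]

theorem third_finite (M₁ : 𝒱.GeneralizedModule W₁) (𝒴 : TruncatedMap W₁ W₂ W₃) (k : ℕ)
    (v : V) (w₁ : W₁) (w₂ : W₂) (l m : ℤ) (n : ℂ) :
    (Function.support fun i : ℕ => (Ring.choose m i : ℤ) •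
      mode 𝒴.1 k (M₁.Y v w₁ (l + (i : ℤ))) w₂ ((m : ℂ) + n - (i : ℂ))).Finite := by
  obtain ⟨N, hN⟩ := nat_bound (M₁.truncation v w₁) l
  refine finite_support_of_bound ⟨N, fun i hi => ?_⟩
  rw [hN i hi, mode, map_zero, LinearMap.zero_apply, Pi.zero_apply, Finsupp.zero_apply, smul_zero]

theorem mode_add (𝒴 𝒵 : W₁ →ₗ[ℂ] W₂ →ₗ[ℂ] LogSeries W₃) (k : ℕ) (w₁ : W₁) (w₂ : W₂)
    (n : ℂ) : mode (𝒴 + 𝒵) k w₁ w₂ n = mode 𝒴 k w₁ w₂ n + mode 𝒵 k w₁ w₂ n := rfl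

theorem mode_smul (a : ℂ) (𝒴 : W₁ →ₗ[ℂ] W₂ →ₗ[ℂ] LogSeries W₃) (k : ℕ) (w₁ : W₁) (w₂ : W₂)
    (n : ℂ) : mode (a • 𝒴) k w₁ w₂ n = a • mode 𝒴 k w₁ w₂ n := rfl

theorem IsLogIntertwiningOperator.add {M₁ : 𝒱.GeneralizedModule W₁} {M₂ : 𝒱.GeneralizedModule W₂}
    {M₃ : 𝒱.GeneralizedModule W₃} {𝒴 𝒵 : TruncatedMap W₁ W₂ W₃}
    (h : IsLogIntertwiningOperator M₁ M₂ M₃ 𝒴) (h' : IsLogIntertwiningOperator M₁ M₂ M₃ 𝒵) :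
    IsLogIntertwiningOperator M₁ M₂ M₃ (𝒴 + 𝒵) where
  jacobi k v w₁ w₂ l m n := by
    have e₁ : jacobiFirst M₃.Y (mode (𝒴 + 𝒵).1 k) v w₁ w₂ l m n
        = jacobiFirst M₃.Y (mode 𝒴.1 k) v w₁ w₂ l m n
          + jacobiFirst M₃.Y (mode 𝒵.1 k) v w₁ w₂ l m n := by
      rw [jacobiFirst, jacobiFirst, jacobiFirst, ← finsum_add_distrib
        (first_finite M₃ 𝒴 k v w₁ w₂ l m n) (first_finite M₃ 𝒵 k v w₁ w₂ l m n)]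
      refine finsum_congr fun i => ?_
      rw [Submodule.coe_add, mode_add, map_add, Pi.add_apply, smul_add]
    have e₂ : jacobiSecond M₂.Y (mode (𝒴 + 𝒵).1 k) v w₁ w₂ l m n
        = jacobiSecond M₂.Y (mode 𝒴.1 k) v w₁ w₂ l m n
          + jacobiSecond M₂.Y (mode 𝒵.1 k) v w₁ w₂ l m n := by
      rw [jacobiSecond, jacobiSecond, jacobiSecond, ← finsum_add_distrib
        (second_finite M₂ 𝒴 k v w₁ w₂ l m n) (second_finite M₂ 𝒵 k v w₁ w₂ l m n)]
      refine finsum_congr fun i => ?_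
      rw [Submodule.coe_add, mode_add, smul_add]
    have e₃ : jacobiThird M₁.Y (mode (𝒴 + 𝒵).1 k) v w₁ w₂ l m n
        = jacobiThird M₁.Y (mode 𝒴.1 k) v w₁ w₂ l m n
          + jacobiThird M₁.Y (mode 𝒵.1 k) v w₁ w₂ l m n := by
      rw [jacobiThird, jacobiThird, jacobiThird, ← finsum_add_distrib
        (third_finite M₁ 𝒴 k v w₁ w₂ l m n) (third_finite M₁ 𝒵 k v w₁ w₂ l m n)]
      refine finsum_congr fun i => ?_
      rw [Submodule.coe_add, mode_add, smul_add]
    rw [e₁, e₂, e₃, ← h.jacobi k v w₁ w₂ l m n, ← h'.jacobi k v w₁ w₂ l m n]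
    abel
  derivative w₁ w₂ n k := by
    have h₁ := h.derivative w₁ w₂ n k
    have h₂ := h'.derivative w₁ w₂ n k
    simp only [derivCoeff, Submodule.coe_add, LinearMap.add_apply, Pi.add_apply,
      Finsupp.add_apply, smul_add] at h₁ h₂ ⊢
    rw [h₁, h₂]
    abel
  bracket k := by
    have h₁ := h.bracket k
    have h₂ := h'.bracket k
    refine ⟨fun w₁ w₂ n => ?_, fun w₁ w₂ n => ?_, fun w₁ w₂ n => ?_⟩
    · simp only [Submodule.coe_add, mode_add, map_add, ← h₁.neg, ← h₂.neg]
      abel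
    · have a₁ := h₁.zero w₁ w₂ n
      have a₂ := h₂.zero w₁ w₂ n
      simp only [Submodule.coe_add, mode_add, map_add]
      rw [add_sub_add_comm, a₁, a₂]
      abel
    · have a₁ := h₁.pos w₁ w₂ n
      have a₂ := h₂.pos w₁ w₂ n
      simp only [Submodule.coe_add, mode_add, map_add]
      rw [add_sub_add_comm, a₁, a₂, smul_add]
      abel

theorem IsLogIntertwiningOperator.smul {M₁ : 𝒱.GeneralizedModule W₁}
    {M₂ : 𝒱.GeneralizedModule W₂} {M₃ : 𝒱.GeneralizedModule W₃} {𝒴 : TruncatedMap W₁ W₂ W₃}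
    (a : ℂ) (h : IsLogIntertwiningOperator M₁ M₂ M₃ 𝒴) :
    IsLogIntertwiningOperator M₁ M₂ M₃ (a • 𝒴) where
  jacobi k v w₁ w₂ l m n := by
    have e₁ : jacobiFirst M₃.Y (mode (a • 𝒴).1 k) v w₁ w₂ l m n
        = a • jacobiFirst M₃.Y (mode 𝒴.1 k) v w₁ w₂ l m n := by
      rw [jacobiFirst, jacobiFirst, smul_finsum]
      refine finsum_congr fun i => ?_
      rw [Submodule.coe_smul, mode_smul, map_smul, Pi.smul_apply, smul_comm]
    have e₂ : jacobiSecond M₂.Y (mode (a • 𝒴).1 k) v w₁ w₂ l m n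
        = a • jacobiSecond M₂.Y (mode 𝒴.1 k) v w₁ w₂ l m n := by
      rw [jacobiSecond, jacobiSecond, smul_finsum]
      refine finsum_congr fun i => ?_
      rw [Submodule.coe_smul, mode_smul, smul_comm]
    have e₃ : jacobiThird M₁.Y (mode (a • 𝒴).1 k) v w₁ w₂ l m n
        = a • jacobiThird M₁.Y (mode 𝒴.1 k) v w₁ w₂ l m n := by
      rw [jacobiThird, jacobiThird, smul_finsum]
      refine finsum_congr fun i => ?_
      rw [Submodule.coe_smul, mode_smul, smul_comm]
    rw [e₁, e₂, e₃, ← h.jacobi k v w₁ w₂ l m n, smul_sub]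
  derivative w₁ w₂ n k := by
    have h₁ := h.derivative w₁ w₂ n k
    simp only [derivCoeff, Submodule.coe_smul, LinearMap.smul_apply, Pi.smul_apply,
      Finsupp.smul_apply] at h₁ ⊢
    rw [h₁, smul_add, smul_comm a, smul_comm a]
  bracket k := by
    have h₁ := h.bracket k
    refine ⟨fun w₁ w₂ n => ?_, fun w₁ w₂ n => ?_, fun w₁ w₂ n => ?_⟩
    · simp only [Submodule.coe_smul, mode_smul, map_smul, ← smul_sub, h₁.neg]
    · simp only [Submodule.coe_smul, mode_smul, map_smul, ← smul_sub, h₁.zero, smul_add]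
    · simp only [Submodule.coe_smul, mode_smul, map_smul, ← smul_sub, h₁.pos, smul_add,
        smul_comm a]

/-- The vector space of logarithmic intertwining operators of type `(W₃; W₁ W₂)`. -/
def logIntertwiningOperators (M₁ : 𝒱.GeneralizedModule W₁) (M₂ : 𝒱.GeneralizedModule W₂)
    (M₃ : 𝒱.GeneralizedModule W₃) : Submodule ℂ (TruncatedMap W₁ W₂ W₃) where
  carrier := {𝒴 | IsLogIntertwiningOperator M₁ M₂ M₃ 𝒴}
  add_mem' h h' := h.add h'
  zero_mem' := by
    refine ⟨fun k v w₁ w₂ l m n => ?_, fun w₁ w₂ n k => ?_, fun k => ⟨?_, ?_, ?_⟩⟩ <;>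
      simp [jacobiFirst, jacobiSecond, jacobiThird, derivCoeff, mode]
  smul_mem' a _ h := h.smul a

section Graded

variable {B : Type*} [AddCommGroup B] {A : AddSubgroup B} {G : 𝒱.StrongGrading A}
  {M₁ : 𝒱.GeneralizedModule W₁} {M₂ : 𝒱.GeneralizedModule W₂} {M₃ : 𝒱.GeneralizedModule W₃}

/-- The vector space `𝒱_{W₁ W₂}^{W₃}` of grading-compatible logarithmic intertwining operators of
type `(W₃; W₁ W₂)`, for strongly graded generalized modules. -/
def gradedLogIntertwiningOperators (G₁ : M₁.StrongGrading G) (G₂ : M₂.StrongGrading G)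
    (G₃ : M₃.StrongGrading G) : Submodule ℂ (TruncatedMap W₁ W₂ W₃) where
  carrier := {𝒴 | 𝒴 ∈ logIntertwiningOperators M₁ M₂ M₃ ∧
    ∀ β γ, ∀ w₁ ∈ G₁.space β, ∀ w₂ ∈ G₂.space γ, ∀ n k, mode 𝒴.1 k w₁ w₂ n ∈ G₃.space (β + γ)}
  add_mem' h h' := ⟨add_mem h.1 h'.1, fun β γ w₁ hw₁ w₂ hw₂ n k =>
    add_mem (h.2 β γ w₁ hw₁ w₂ hw₂ n k) (h'.2 β γ w₁ hw₁ w₂ hw₂ n k)⟩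
  zero_mem' := ⟨zero_mem _, fun _ _ _ _ _ _ _ _ => zero_mem _⟩
  smul_mem' a _ h := ⟨Submodule.smul_mem _ a h.1, fun β γ w₁ hw₁ w₂ hw₂ n k =>
    Submodule.smul_mem _ a (h.2 β γ w₁ hw₁ w₂ hw₂ n k)⟩

/-- The fusion rule `N_{W₁ W₂}^{W₃}`, the dimension of `𝒱_{W₁ W₂}^{W₃}` (a cardinal number). -/
def fusionRule (G₁ : M₁.StrongGrading G) (G₂ : M₂.StrongGrading G) (G₃ : M₃.StrongGrading G) :
    Cardinal :=
  Module.rank ℂ ↥(gradedLogIntertwiningOperators G₁ G₂ G₃)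

end Graded

/-- The operator `Ω_r`, with `Ω_r(𝒴)(w₂, x) w₁ = e^(x L(-1)) 𝒴(w₁, e^((2r+1)πi) x) w₂`, where `L(-1)`
acts on `W₃`. -/
def Omega (M₃ : 𝒱.GeneralizedModule W₃) (r : ℤ) (𝒴 : TruncatedMap W₁ W₂ W₃) :
    TruncatedMap W₂ W₁ W₃ :=
  ⟨LinearMap.mk₂ ℂ
    (fun w₂ w₁ => expMul M₃.L.neg (substExp ((2 * r + 1) * Real.pi * Complex.I) (𝒴.1 w₁ w₂)))
    (fun w₂ w₂' w₁ => by
      rw [map_add, map_add]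
      exact expMul_add _ ((𝒴.2 w₁ w₂).map _) ((𝒴.2 w₁ w₂').map _))
    (fun a w₂ w₁ => by rw [map_smul, map_smul, expMul_smul])
    (fun w₂ w₁ w₁' => by
      rw [map_add, LinearMap.add_apply, map_add]
      exact expMul_add _ ((𝒴.2 w₁ w₂).map _) ((𝒴.2 w₁' w₂).map _))
    (fun a w₂ w₁ => by rw [map_smul, LinearMap.smul_apply, map_smul, expMul_smul]),
  fun w₂ w₁ => ((𝒴.2 w₁ w₂).map _).expMul _⟩

end Intertwining

end LogVA

end

noncomputable section

namespace LogVA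

/-! ## Finite sums and binomial coefficients -/

/-! This is skew-symmetry. Write `T` for `L(-1)` on `W₃` and `f(x) = 𝒴(w₁, e^ζ x) w₂` with `ζ =
(2r+1)πi`. Since `e^ζ = -1`, every relation between coefficients whose exponents differ by integers
sees the substitution only as `x ↦ -x`. The rest of it, the scalars `e^(ζ n)` and the shift of `log
x`, is an invertible operator common to all terms.

Jacobi identity: `[T, Y₃(v, x₁)] = (d/dx₁) Y₃(v, x₁)` gives `e^(-xT) Y₃(v, x₁) e^(xT) = Y₃(v, x₁ -
x)`. Hence moving `e^(xT)` to the left turns the coefficient functions `(x₁ - x)^l x₁^m` into `x₁^l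
(x₁ + x)^m`. These are the ones in the identity for `f` with `l` and `m` exchanged, while the other
two terms trade places (`sum_apply_expSeries`, `jacobi_expSeries`).

Bracket relations: conjugation by `e^(xT)` sends `L(0)` to `L(0) + xT` and `L(1)` to `L(1) + 2xL(0)
+ x²T`. Inserting the relations for `𝒴` at `-x`, all unwanted terms cancel. The derivative property
follows from `(e^(xT) f)' = e^(xT) (f' + T f)`.

Inverse: `Ω_r` and `Ω_{-r-1}` use opposite `ζ`, and the second substitution turns `e^(xT)` into
`e^(-xT)` (`Omega_Omega`). As `L(-1)` preserves the second grading, `Ω_r` restricts to the graded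
spaces, and the isomorphism and the equality of dimensions follow. -/

theorem sum_range_sum_range_eq_sum_antidiagonal {M : Type*} [AddCommMonoid M] (f : ℕ → ℕ → M)
    (N : ℕ) (h : ∀ i j, N ≤ i + j → f i j = 0) :
    ∑ i ∈ Finset.range N, ∑ j ∈ Finset.range N, f i j
      = ∑ k ∈ Finset.range N, ∑ p ∈ Finset.HasAntidiagonal.antidiagonal k, f p.1 p.2 := by
  rw [← Finset.sum_product', Finset.sum_sigma']
  -- The square contains the triangle `i + j < N`, and only vanishing terms lie outside it, so it
  -- suffices to match the nonzero terms.
  refine Finset.sum_bij_ne_zero (fun p _ _ => ⟨p.1 + p.2, p⟩) ?_ ?_ ?_ ?_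
  · intro p _ hne
    have : p.1 + p.2 < N := by
      by_contra hlt
      exact hne (h _ _ (not_lt.mp hlt))
    simpa using this
  · rintro p _ _ q _ _ hpq
    simpa using (Sigma.mk.inj_iff.mp hpq).2
  · rintro ⟨k, p⟩ hk hne
    simp only [Finset.mem_sigma, Finset.mem_range, Finset.HasAntidiagonal.mem_antidiagonal] at hk
    obtain ⟨hk, rfl⟩ := hk
    exact ⟨p, by simp only [Finset.mem_product, Finset.mem_range]; omega, hne, rfl⟩
  · intro p _ _
    rfl

theorem finsum_eq_sum_range {M : Type*} [AddCommMonoid M] {f : ℕ → M} {N : ℕ}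
    (h : ∀ i, N ≤ i → f i = 0) : ∑ᶠ i, f i = ∑ i ∈ Finset.range N, f i := by
  refine finsum_eq_sum_of_support_subset f fun i hi => ?_
  by_contra hlt
  exact hi (h i (by simpa using hlt))

theorem choose_neg_eq (n : ℤ) (k : ℕ) :
    Ring.choose n k = (-1) ^ k * Ring.choose ((k : ℤ) - 1 - n) k := by
  have h := Ring.choose_neg (-n) k
  rw [neg_neg] at h
  rw [h, show (k : ℤ) - 1 - n = -n + k - 1 by ring]
  simp [Int.negOnePow_def, Units.smul_def]

/-- After negating the upper entry, the second binomial has upper entry `t - 1 - m - l`, constant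
along the antidiagonal, so the Vandermonde identity applies. The identity is the numerical content
of `(x₁ - x)^l x₁^m` becoming `x₁^l (x₁ + x)^m` under `x₁ ↦ x₁ + x`. -/
theorem sum_antidiagonal_neg_one_pow_choose_mul_choose (l m : ℤ) (t : ℕ) :
    ∑ p ∈ Finset.HasAntidiagonal.antidiagonal t,
      (-1) ^ p.1 * Ring.choose l p.1 * Ring.choose (l + m - (p.1 : ℤ)) p.2 = Ring.choose m t := by
  rw [choose_neg_eq m t, show (t : ℤ) - 1 - m = l + (t - 1 - m - l) by ring,
    Ring.add_choose_eq t (Commute.all _ _), Finset.mul_sum]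
  refine Finset.sum_congr rfl fun p hp => ?_
  obtain rfl := Finset.HasAntidiagonal.mem_antidiagonal.mp hp
  rw [choose_neg_eq (l + m - p.1) p.2, pow_add]
  push_cast
  rw [show (p.2 : ℤ) - 1 - (l + m - p.1) = p.1 + p.2 - 1 - m - l by ring]
  ring

/-- The absorption identity, needed for the recursion satisfied by the iterated commutators of `v_p`
with `L(-1)`. -/
theorem choose_mul_sub (p : ℤ) (s : ℕ) :
    Ring.choose p s * (p - s) = (s + 1) * Ring.choose p (s + 1) := by
  have h := Ring.choose_smul_choose p (Nat.le_succ s)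
  rw [Nat.succ_eq_add_one, Nat.choose_succ_self_right, Nat.add_sub_cancel_left,
    Ring.choose_one_right] at h
  rw [← h, nsmul_eq_mul]
  push_cast
  ring

/-! ## Truncated series and multiplication by the exponential of an operator -/

section ExpSeries

variable {F : Type*} [AddCommGroup F]

/-- The lower truncation condition for a formal series with coefficients in `F`. -/
def IsTruncated (f : ℂ → F) : Prop := ∀ n : ℂ, ∃ M : ℕ, ∀ m : ℕ, M ≤ m → f (n - m) = 0

theorem IsTruncated.add {f g : ℂ → F} (hf : IsTruncated f) (hg : IsTruncated g) :
    IsTruncated fun n => f n + g n := by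
  intro n
  obtain ⟨M, hM⟩ := hf n
  obtain ⟨N, hN⟩ := hg n
  exact ⟨max M N, fun m hm => by
    simp only [hM m (le_of_max_le_left hm), hN m (le_of_max_le_right hm), add_zero]⟩

theorem IsTruncated.sub {f g : ℂ → F} (hf : IsTruncated f) (hg : IsTruncated g) :
    IsTruncated fun n => f n - g n := by
  intro n
  obtain ⟨M, hM⟩ := hf n
  obtain ⟨N, hN⟩ := hg n
  exact ⟨max M N, fun m hm => by
    simp only [hM m (le_of_max_le_left hm), hN m (le_of_max_le_right hm), sub_zero]⟩

theorem IsTruncated.smul {R : Type*} [SMulZeroClass R F] {f : ℂ → F} (hf : IsTruncated f) (c : R) :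
    IsTruncated fun n => c • f n := by
  intro n
  obtain ⟨M, hM⟩ := hf n
  exact ⟨M, fun m hm => by simp only [hM m hm, smul_zero]⟩

theorem IsTruncated.shift {f : ℂ → F} (hf : IsTruncated f) (c : ℂ) :
    IsTruncated fun n => f (n - c) := by
  intro n
  obtain ⟨M, hM⟩ := hf (n - c)
  exact ⟨M, fun m hm => by simpa only [sub_right_comm] using hM m hm⟩

theorem IsTruncated.sum {ι : Type*} {f : ι → ℂ → F} (hf : ∀ i, IsTruncated (f i))
    (s : Finset ι) : IsTruncated fun x => ∑ i ∈ s, f i x := by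
  classical
  induction s using Finset.induction_on with
  | empty => exact fun n => ⟨0, fun m _ => by simp⟩
  | insert a s ha ih => simpa only [Finset.sum_insert ha] using (hf a).add ih

variable [Module ℂ F]

/-- The divided power `T^i / i!`. -/
def dividedPower (T : Module.End ℂ F) (i : ℕ) : Module.End ℂ F := ((i ! : ℂ)⁻¹) • T ^ i

theorem dividedPower_zero (T : Module.End ℂ F) : dividedPower T 0 = 1 := by
  simp [dividedPower]

theorem succ_smul_dividedPower_succ (T : Module.End ℂ F) (i : ℕ) :
    ((i : ℂ) + 1) • dividedPower T (i + 1) = dividedPower T i * T := by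
  have h : (i : ℂ) + 1 ≠ 0 := Nat.cast_add_one_ne_zero i
  rw [dividedPower, dividedPower, smul_smul, Nat.factorial_succ, smul_mul_assoc, pow_succ]
  congr 1
  push_cast
  rw [mul_inv, ← mul_assoc, mul_inv_cancel₀ h, one_mul]

/-- The product `e^(xT) f(x)`. -/
def expSeries (T : Module.End ℂ F) (f : ℂ → F) : ℂ → F := fun n =>
  ∑ᶠ i : ℕ, dividedPower T i (f (n - i))

theorem expSeries_eq_sum (T : Module.End ℂ F) {f : ℂ → F} {n : ℂ} {N : ℕ}
    (h : ∀ i : ℕ, N ≤ i → f (n - i) = 0) :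
    expSeries T f n = ∑ i ∈ Finset.range N, dividedPower T i (f (n - i)) :=
  finsum_eq_sum_range fun i hi => by rw [h i hi, map_zero]

theorem expSeries_congr (T : Module.End ℂ F) {f g : ℂ → F} {n : ℂ}
    (h : ∀ i : ℕ, f (n - i) = g (n - i)) : expSeries T f n = expSeries T g n :=
  finsum_congr fun i => by rw [h i]

theorem expSeries_shift (T : Module.End ℂ F) (f : ℂ → F) (c n : ℂ) :
    expSeries T (fun x => f (x - c)) n = expSeries T f (n - c) :=
  finsum_congr fun i => by rw [sub_right_comm]

theorem IsTruncated.finite_support {f : ℂ → F} (hf : IsTruncated f) (T : Module.End ℂ F) (n : ℂ) :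
    (Function.support fun i : ℕ => dividedPower T i (f (n - i))).Finite := by
  obtain ⟨M, hM⟩ := hf n
  exact finite_support_of_bound ⟨M, fun i hi => by rw [hM i hi, map_zero]⟩

theorem IsTruncated.map {F' : Type*} [AddCommGroup F'] [Module ℂ F'] {f : ℂ → F}
    (hf : IsTruncated f) (S : F →ₗ[ℂ] F') : IsTruncated fun n => S (f n) := by
  intro n
  obtain ⟨M, hM⟩ := hf n
  exact ⟨M, fun m hm => by simp only [hM m hm, map_zero]⟩

theorem IsTruncated.smul_fun {f : ℂ → F} (hf : IsTruncated f) (c : ℂ → ℂ) :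
    IsTruncated fun n => c n • f n := by
  intro n
  obtain ⟨M, hM⟩ := hf n
  exact ⟨M, fun m hm => by simp only [hM m hm, smul_zero]⟩

theorem expSeries_add (T : Module.End ℂ F) {f g : ℂ → F} (hf : IsTruncated f)
    (hg : IsTruncated g) (n : ℂ) :
    expSeries T (fun x => f x + g x) n = expSeries T f n + expSeries T g n := by
  rw [expSeries, expSeries, expSeries,
    ← finsum_add_distrib (hf.finite_support T n) (hg.finite_support T n)]
  exact finsum_congr fun i => map_add _ _ _

theorem expSeries_map (T S : Module.End ℂ F) (h : Commute S T) {f : ℂ → F} (hf : IsTruncated f)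
    (n : ℂ) : expSeries T (fun x => S (f x)) n = S (expSeries T f n) := by
  obtain ⟨N, hN⟩ := hf n
  rw [expSeries_eq_sum T hN, expSeries_eq_sum T (N := N) fun i hi => by rw [hN i hi, map_zero],
    map_sum]
  refine Finset.sum_congr rfl fun i _ => ?_
  have hc : Commute S (dividedPower T i) := (h.pow_right i).smul_right _
  exact (LinearMap.congr_fun hc.eq _).symm

theorem expSeries_smul (T : Module.End ℂ F) (c : ℂ) (f : ℂ → F) (n : ℂ) :
    expSeries T (fun x => c • f x) n = c • expSeries T f n := by
  rw [expSeries, expSeries, smul_finsum]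
  exact finsum_congr fun i => map_smul _ _ _

theorem expSeries_zsmul (T : Module.End ℂ F) (c : ℤ) (f : ℂ → F) (n : ℂ) :
    expSeries T (fun x => c • f x) n = c • expSeries T f n := by
  simpa only [Int.cast_smul_eq_zsmul] using expSeries_smul T (c : ℂ) f n

theorem expSeries_sub (T : Module.End ℂ F) {f g : ℂ → F} (hf : IsTruncated f)
    (hg : IsTruncated g) (n : ℂ) :
    expSeries T (fun x => f x - g x) n = expSeries T f n - expSeries T g n := by
  have h := expSeries_add T hf (hg.smul (-1 : ℤ)) n
  rw [expSeries_zsmul] at h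
  simpa [sub_eq_add_neg] using h

theorem expSeries_sum (T : Module.End ℂ F) {ι : Type*} {f : ι → ℂ → F}
    (hf : ∀ i, IsTruncated (f i)) (s : Finset ι) (n : ℂ) :
    expSeries T (fun x => ∑ i ∈ s, f i x) n = ∑ i ∈ s, expSeries T (f i) n := by
  classical
  induction s using Finset.induction_on with
  | empty => simp [expSeries]
  | insert a s ha ih =>
    simp only [Finset.sum_insert ha]
    rw [expSeries_add T (hf a) (IsTruncated.sum hf s), ih]

/-- The terms are multiples of `T ^ k`, and their scalars add up to the `k`-th coefficient of the
power series identity `exp(x) exp(-x) = 1`. -/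
theorem sum_antidiagonal_dividedPower_neg (T : Module.End ℂ F) (k : ℕ) :
    ∑ p ∈ Finset.HasAntidiagonal.antidiagonal k, dividedPower T p.1 * dividedPower (-T) p.2
      = if k = 0 then 1 else 0 := by
  have h := congr_arg (PowerSeries.coeff k) (PowerSeries.exp_mul_exp_neg_eq_one (A := ℂ))
  rw [PowerSeries.coeff_mul, PowerSeries.coeff_one] at h
  have e : ∀ p ∈ Finset.HasAntidiagonal.antidiagonal k, dividedPower T p.1 * dividedPower (-T) p.2
      = (PowerSeries.coeff p.1 (PowerSeries.exp ℂ)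
        * PowerSeries.coeff p.2 (PowerSeries.evalNegHom (PowerSeries.exp ℂ))) • T ^ k := by
    intro p hp
    obtain rfl := Finset.HasAntidiagonal.mem_antidiagonal.mp hp
    rw [PowerSeries.evalNegHom, PowerSeries.coeff_rescale, PowerSeries.coeff_exp,
      PowerSeries.coeff_exp, dividedPower, dividedPower, neg_pow, pow_add]
    rcases Nat.even_or_odd p.2 with hp | hp <;>
      simp [hp.neg_one_pow, smul_smul, mul_comm]
  rw [Finset.sum_congr rfl e, ← Finset.sum_smul, h]
  split_ifs with hk
  · rw [hk, pow_zero, one_smul]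
  · rw [zero_smul]

theorem expSeries_expSeries_neg (T : Module.End ℂ F) {f : ℂ → F} (hf : IsTruncated f) (n : ℂ) :
    expSeries T (expSeries (-T) f) n = f n := by
  obtain ⟨N, hN⟩ := hf n
  -- With `N + 1` instead of `N`, the range always contains the index `0`, which carries the only
  -- surviving term `f n`.
  have hz : ∀ i j : ℕ, N + 1 ≤ i + j → f (n - i - j) = 0 := fun i j hij => by
    rw [sub_sub, ← Nat.cast_add, hN _ (by omega)]
  rw [expSeries_eq_sum T (N := N + 1) fun i hi =>
    finsum_eq_zero_of_forall_eq_zero fun j => by rw [hz i j (by omega), map_zero]]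
  have e : ∀ i ∈ Finset.range (N + 1), dividedPower T i (expSeries (-T) f (n - i))
      = ∑ j ∈ Finset.range (N + 1), dividedPower T i (dividedPower (-T) j (f (n - i - j))) :=
    fun i _ => by
      rw [expSeries_eq_sum (-T) (N := N + 1) fun j hj => hz i j (by omega), map_sum]
  rw [Finset.sum_congr rfl e, sum_range_sum_range_eq_sum_antidiagonal _ _
    fun i j hij => by rw [hz i j hij, map_zero, map_zero]]
  have e' : ∀ k ∈ Finset.range (N + 1), ∑ p ∈ Finset.HasAntidiagonal.antidiagonal k,
      dividedPower T p.1 (dividedPower (-T) p.2 (f (n - p.1 - p.2)))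
      = if k = 0 then f n else 0 := by
    intro k _
    have h := LinearMap.congr_fun (sum_antidiagonal_dividedPower_neg T k) (f (n - k))
    rw [LinearMap.sum_apply] at h
    refine (Finset.sum_congr rfl fun p hp => ?_).trans (h.trans ?_)
    · rw [sub_sub, ← Nat.cast_add, Finset.HasAntidiagonal.mem_antidiagonal.mp hp]
      rfl
    split_ifs with hk
    · simp [hk]
    · simp
  rw [Finset.sum_congr rfl e', Finset.sum_ite_eq']
  simp

/-- The coefficient of `x^j` in `R₀ e^(xT) = e^(xT) ∑ x^s R_s`. The hypothesis forces `R_s = (-ad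
T)^s R₀ / s!`, stated as a recursion so that each application can supply a closed form. -/
theorem mul_dividedPower_eq_sum (T : Module.End ℂ F) (R : ℕ → Module.End ℂ F)
    (hR : ∀ s, R s * T = T * R s + ((s : ℂ) + 1) • R (s + 1)) (j : ℕ) :
    R 0 * dividedPower T j = ∑ p ∈ Finset.HasAntidiagonal.antidiagonal j, dividedPower T p.2 * R p.1 := by
  induction j with
  | zero => simp [dividedPower_zero]
  | succ j ih =>
    have hj : (j : ℂ) + 1 ≠ 0 := Nat.cast_add_one_ne_zero j
    have h₁ := Finset.Nat.sum_antidiagonal_succ (n := j)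
      (f := fun p => (p.1 : ℂ) • (dividedPower T p.2 * R p.1))
    have h₂ := Finset.Nat.sum_antidiagonal_succ' (n := j)
      (f := fun p => (p.2 : ℂ) • (dividedPower T p.2 * R p.1))
    -- On this antidiagonal `j + 1 = p.1 + p.2`. The part weighted by `p.1` will match the
    -- commutator terms `(s + 1) R_{s+1}`, and the part weighted by `p.2` the terms in which `T` has
    -- passed to the left of `R_s`.
    have h₃ : ∑ p ∈ Finset.HasAntidiagonal.antidiagonal (j + 1), ((j : ℂ) + 1) • (dividedPower T p.2 * R p.1)
        = ∑ p ∈ Finset.HasAntidiagonal.antidiagonal (j + 1), (p.1 : ℂ) • (dividedPower T p.2 * R p.1)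
          + ∑ p ∈ Finset.HasAntidiagonal.antidiagonal (j + 1), (p.2 : ℂ) • (dividedPower T p.2 * R p.1) := by
      rw [← Finset.sum_add_distrib]
      refine Finset.sum_congr rfl fun p hp => ?_
      rw [← add_smul, ← Nat.cast_add, Finset.HasAntidiagonal.mem_antidiagonal.mp hp, Nat.cast_succ]
    rw [← (smul_right_injective _ hj).eq_iff]
    rw [← mul_smul_comm, succ_smul_dividedPower_succ, ← mul_assoc, ih, Finset.sum_mul,
      Finset.smul_sum, h₃, h₁, h₂]
    simp only [Nat.cast_zero, zero_smul, zero_add, Nat.cast_add, Nat.cast_one]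
    rw [← Finset.sum_add_distrib]
    refine Finset.sum_congr rfl fun p _ => ?_
    rw [mul_assoc, hR, mul_add, ← mul_assoc, ← succ_smul_dividedPower_succ, smul_mul_assoc,
      mul_smul_comm, add_comm]

/-- Moving an operator across `e^(xT)`. -/
theorem apply_expSeries (T : Module.End ℂ F) (R : ℕ → Module.End ℂ F)
    (hR : ∀ s, R s * T = T * R s + ((s : ℂ) + 1) • R (s + 1)) {f : ℂ → F} {n : ℂ} {N : ℕ}
    (hN : ∀ i : ℕ, N ≤ i → f (n - i) = 0) :
    R 0 (expSeries T f n)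
      = ∑ s ∈ Finset.range N, expSeries T (fun x => R s (f x)) (n - s) := by
  have hz : ∀ i j : ℕ, N ≤ i + j → f (n - i - j) = 0 := fun i j hij => by
    rw [sub_sub, ← Nat.cast_add, hN _ hij]
  rw [expSeries_eq_sum T hN, map_sum, Finset.sum_congr rfl fun s _ =>
    expSeries_eq_sum T (f := fun x => R s (f x)) (n := n - s) (N := N) fun j hj => by
      rw [hz s j (by omega), map_zero],
    sum_range_sum_range_eq_sum_antidiagonal _ _ fun i j hij => by
      rw [hz i j hij, map_zero, map_zero]]
  refine Finset.sum_congr rfl fun j _ => ?_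
  have h := LinearMap.congr_fun (mul_dividedPower_eq_sum T R hR j) (f (n - j))
  rw [LinearMap.sum_apply] at h
  refine h.trans (Finset.sum_congr rfl fun p hp => ?_)
  rw [sub_sub, ← Nat.cast_add, Finset.HasAntidiagonal.mem_antidiagonal.mp hp]
  rfl

end ExpSeries

/-! ## Skew-symmetry of the Jacobi identity -/

section Jacobi

variable {F : Type*} [AddCommGroup F] [Module ℂ F]

/-- With `D p` the modes of `Y₃(v, x₁)`, this compares residues in `x₁`: `(x₁ - x)^l x₁^m Y₃(v, x₁)
e^(xT) f` and `e^(xT) x₁^l (x₁ + x)^m Y₃(v, x₁) f` have the same one. -/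
theorem sum_apply_expSeries (T : Module.End ℂ F) (D : ℤ → Module.End ℂ F)
    (hD : ∀ p, D p * T = T * D p + (p : ℂ) • D (p - 1)) {f : ℂ → F} (hf : IsTruncated f)
    (l m : ℤ) {n : ℂ} {N : ℕ} (hN : ∀ i : ℕ, N ≤ i → f (n - i) = 0) :
    ∑ i ∈ Finset.range N, ((-1) ^ i * Ring.choose l i : ℤ) •
        D (l + m - i) (expSeries T f (n - i))
      = expSeries T (fun x => ∑ t ∈ Finset.range N, (Ring.choose m t : ℤ) •
        D (l + m - t) (f (x - t))) n := by
  have hz : ∀ i j : ℕ, N ≤ i + j → f (n - i - j) = 0 := fun i j hij => by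
    rw [sub_sub, ← Nat.cast_add, hN _ hij]
  -- The divided iterated commutators of `D p` with `T` are `(p choose s) D (p - s)`.
  have hR : ∀ (p : ℤ) (s : ℕ), ((Ring.choose p s : ℤ) • D (p - s)) * T
      = T * ((Ring.choose p s : ℤ) • D (p - s))
        + ((s : ℂ) + 1) • (Ring.choose p (s + 1) : ℤ) • D (p - (s + 1 : ℕ)) := by
    intro p s
    have h := congr_arg (Int.cast : ℤ → ℂ) (choose_mul_sub p s)
    push_cast at h
    rw [smul_mul_assoc, hD, mul_smul_comm, smul_add, ← Int.cast_smul_eq_zsmul ℂ,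
      ← Int.cast_smul_eq_zsmul ℂ, ← Int.cast_smul_eq_zsmul ℂ, smul_smul, smul_smul, ← h]
    push_cast
    rw [sub_sub]
  have e : ∀ i ∈ Finset.range N, ((-1) ^ i * Ring.choose l i : ℤ) •
      D (l + m - i) (expSeries T f (n - i))
      = ∑ s ∈ Finset.range N, ((-1) ^ i * Ring.choose l i * Ring.choose (l + m - i) s : ℤ) •
        expSeries T (fun x => D (l + m - i - s) (f x)) (n - i - s) := by
    intro i _
    have h := apply_expSeries T (fun s => (Ring.choose (l + m - i) s : ℤ) • D (l + m - i - s))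
      (hR _) (f := f) (n := n - i) (N := N) fun j hj => hz i j (by omega)
    simp only [Ring.choose_zero_right, one_smul, Nat.cast_zero, sub_zero,
      LinearMap.smul_apply, expSeries_zsmul] at h
    rw [h, Finset.smul_sum]
    exact Finset.sum_congr rfl fun s _ => smul_smul _ _ _
  -- Both the operator `D (l + m - t)` and the shift of the exponent depend only on `t = i + s`, so
  -- the coefficients on each antidiagonal can be added up.
  rw [Finset.sum_congr rfl e, sum_range_sum_range_eq_sum_antidiagonal]
  · rw [expSeries_sum T (f := fun (t : ℕ) x => (Ring.choose m t : ℤ) • D (l + m - t) (f (x - t)))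
      fun t => ((hf.map (D (l + m - t))).shift t).smul (Ring.choose m t : ℤ)]
    refine Finset.sum_congr rfl fun t _ => ?_
    rw [expSeries_zsmul, expSeries_shift T (fun x => D (l + m - t) (f x)),
      ← sum_antidiagonal_neg_one_pow_choose_mul_choose l m t, Finset.sum_smul]
    refine Finset.sum_congr rfl fun p hp => ?_
    obtain rfl := Finset.HasAntidiagonal.mem_antidiagonal.mp hp
    rw [sub_sub, sub_sub, ← Nat.cast_add, ← Nat.cast_add]
  · intro i j hij
    rw [expSeries, finsum_eq_zero_of_forall_eq_zero, smul_zero]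
    intro a
    rw [sub_sub n, sub_sub n, ← Nat.cast_add, ← Nat.cast_add, hN _ (by omega), map_zero, map_zero]

/-- Multiplication by `e^(xT)` turns the Jacobi identity for `f(x) = 𝒴(w₁, -x) w₂`, together with
`p_i = 𝒴(v_i w₁, -x) w₂` and `q_i = 𝒴(w₁, -x) v_i w₂`, into the Jacobi identity with the roles of
`w₁` and `w₂` exchanged. -/
theorem jacobi_expSeries (T : Module.End ℂ F) (D : ℤ → Module.End ℂ F)
    (hD : ∀ p, D p * T = T * D p + (p : ℂ) • D (p - 1)) {f : ℂ → F} (hf : IsTruncated f)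
    {p q : ℤ → ℂ → F} (hp : ∀ i, IsTruncated (p i)) (hq : ∀ i, IsTruncated (q i))
    (hp' : ∃ N : ℤ, ∀ i ≥ N, p i = 0) (hq' : ∃ N : ℤ, ∀ i ≥ N, q i = 0)
    (H : ∀ (l m : ℤ) (n : ℂ),
      ∑ᶠ i : ℕ, (Ring.choose l i : ℤ) • D (l + m - i) (f (n - i))
        - ∑ᶠ i : ℕ, (Ring.choose l i : ℤ) • q (m + i) (n - l + i)
      = ∑ᶠ i : ℕ, ((m.negOnePow : ℤ) * (-1) ^ i * Ring.choose m i : ℤ) • p (l + i) (n - m + i))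
    (l m : ℤ) (n : ℂ) :
    ∑ᶠ i : ℕ, ((-1) ^ i * Ring.choose l i : ℤ) • D (l + m - i) (expSeries T f (n - i))
        - ∑ᶠ i : ℕ, ((l.negOnePow : ℤ) * (-1) ^ i * Ring.choose l i : ℤ) •
          expSeries T (p (m + i)) (n - l + i)
      = ∑ᶠ i : ℕ, (Ring.choose m i : ℤ) • expSeries T (q (l + i)) (n - m + i) := by
  obtain ⟨N, hN⟩ := hf n
  obtain ⟨K, hK⟩ := nat_bound hp' m
  obtain ⟨J, hJ⟩ := nat_bound hq' l
  have hz : ∀ i j : ℕ, N ≤ i + j → f (n - i - j) = 0 := fun i j hij => by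
    rw [sub_sub, ← Nat.cast_add, hN _ hij]
  have h0 : ∀ x, expSeries T (0 : ℂ → F) x = 0 := fun x => by simp [expSeries]
  have e₁ := sum_apply_expSeries T D hD hf l m hN
  have e₂ := expSeries_sum T
    (f := fun (i : ℕ) x => ((l.negOnePow : ℤ) * (-1) ^ i * Ring.choose l i : ℤ) •
      p (m + i) (x - (l - i))) (fun i => ((hp _).shift _).smul _) (Finset.range K) n
  have e₃ := expSeries_sum T
    (f := fun (i : ℕ) x => (Ring.choose m i : ℤ) • q (l + i) (x - (m - i)))
    (fun i => ((hq _).shift _).smul _) (Finset.range J) n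
  rw [finsum_eq_sum_range (N := N) fun i hi => by
      rw [expSeries, finsum_eq_zero_of_forall_eq_zero fun j => by
        rw [hz i j (by omega), map_zero], map_zero, smul_zero],
    finsum_eq_sum_range (N := K) fun i hi => by rw [hK i hi, h0, smul_zero],
    finsum_eq_sum_range (N := J) fun i hi => by rw [hJ i hi, h0, smul_zero], e₁]
  simp only [expSeries_zsmul, expSeries_shift T (p _), expSeries_shift T (q _)] at e₂ e₃
  simp only [sub_sub_eq_add_sub, add_sub_right_comm] at e₂ e₃
  rw [← e₂, ← e₃, ← expSeries_sub T
    (IsTruncated.sum (fun t : ℕ => ((hf.map (D (l + m - t))).shift t).smul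
      (Ring.choose m t : ℤ)) _)
    (IsTruncated.sum (fun i : ℕ => by
      simpa only [sub_sub_eq_add_sub, add_sub_right_comm] using
        ((hp (m + i)).shift (l - i)).smul
          ((l.negOnePow : ℤ) * (-1) ^ i * Ring.choose l i : ℤ)) _)]
  -- Both sides are now `e^(xT)` times a series, and only the exponents `n - a` matter, for which
  -- the bounds chosen at `n` still truncate all sums. The identity for `f` is used with `l` and `m`
  -- exchanged, which reflects the exchange of `x₀` and `x₁`.
  refine expSeries_congr T fun a => ?_
  have h := H m l (n - a)
  rw [finsum_eq_sum_range (N := N) fun i hi => by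
      rw [sub_right_comm, hz i a (by omega), map_zero, smul_zero],
    finsum_eq_sum_range (N := J) fun i hi => by rw [hJ i hi, Pi.zero_apply, smul_zero],
    finsum_eq_sum_range (N := K) fun i hi => by rw [hK i hi, Pi.zero_apply, smul_zero],
    add_comm m l] at h
  rw [sub_eq_iff_eq_add] at h ⊢
  rw [h, add_comm]

end Jacobi

/-! ## Polynomials in `log x` -/

section LogPolynomial

open Polynomial

variable {W : Type*} [AddCommGroup W] [Module ℂ W]

/-- An operator acting on the coefficients of polynomials in `log x`. -/
def coeffwise (T : Module.End ℂ W) : Module.End ℂ (ℕ →₀ W) := Finsupp.mapRange.linearMap T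

@[simp]
theorem coeffwise_apply (T : Module.End ℂ W) (g : ℕ →₀ W) (k : ℕ) :
    coeffwise T g k = T (g k) := rfl

theorem coeffwise_mul (S T : Module.End ℂ W) : coeffwise (S * T) = coeffwise S * coeffwise T := by
  ext; simp

theorem coeffwise_add (S T : Module.End ℂ W) : coeffwise (S + T) = coeffwise S + coeffwise T := by
  ext; simp

theorem coeffwise_smul (a : ℂ) (T : Module.End ℂ W) : coeffwise (a • T) = a • coeffwise T := by
  ext; simp

theorem coeffwise_pow (T : Module.End ℂ W) (i : ℕ) : coeffwise (T ^ i) = coeffwise T ^ i := by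
  induction i with
  | zero => ext; simp
  | succ i ih => rw [pow_succ, pow_succ, coeffwise_mul, ih]

theorem expMul_eq_expSeries (T : Module.End ℂ W) (f : LogSeries W) :
    expMul T f = expSeries (coeffwise T) f := by
  funext n
  refine finsum_congr fun i => ?_
  rw [dividedPower, ← coeffwise_pow]
  rfl

/-- The substitution `log x ↦ ζ + log x`. -/
def logShift (ζ : ℂ) : Module.End ℂ (ℕ →₀ W) :=
  Finsupp.lsum ℂ fun k : ℕ => ∑ j ∈ Finset.range (k + 1),
    ((k.choose j : ℂ) * ζ ^ (k - j)) • (Finsupp.lsingle j : W →ₗ[ℂ] ℕ →₀ W)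

theorem substExp_apply (ζ : ℂ) (f : LogSeries W) (n : ℂ) :
    substExp ζ f n = Complex.exp (ζ * n) • logShift ζ (f n) := rfl

/-- The derivative with respect to `log x`. -/
def logDeriv : Module.End ℂ (ℕ →₀ W) :=
  -- At `k = 0` the truncated `k - 1` is harmless, since the scalar is zero.
  Finsupp.lsum ℂ fun k : ℕ => (k : ℂ) • (Finsupp.lsingle (k - 1) : W →ₗ[ℂ] ℕ →₀ W)

theorem logDeriv_apply (g : ℕ →₀ W) (k : ℕ) : logDeriv g k = ((k : ℂ) + 1) • g (k + 1) := by
  induction g using Finsupp.induction_linear with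
  | zero => simp
  | add f g hf hg => rw [map_add, Finsupp.add_apply, hf, hg, Finsupp.add_apply, smul_add]
  | single j w =>
    rcases j with _ | j
    · simp [logDeriv]
    · by_cases h : j = k
      · subst h
        simp [logDeriv]
      · simp [logDeriv, h]

/-- The polynomial `p(log x) w`. -/
def logPolynomial (w : W) : ℂ[X] →ₗ[ℂ] ℕ →₀ W :=
  Polynomial.lsum fun k => Finsupp.lsingle k ∘ₗ LinearMap.toSpanSingleton ℂ W w

theorem logPolynomial_monomial (w : W) (k : ℕ) (a : ℂ) :
    logPolynomial w (monomial k a) = Finsupp.single k (a • w) := by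
  simp [logPolynomial, Polynomial.lsum, Polynomial.sum_monomial_index]

theorem logPolynomial_X_pow (w : W) (k : ℕ) : logPolynomial w (X ^ k) = Finsupp.single k w := by
  rw [X_pow_eq_monomial, logPolynomial_monomial, one_smul]

/-- Identifies the shift of `log x` with the Taylor shift of polynomials, from which its inverse and
its compatibility with the derivative are inherited. -/
theorem logShift_logPolynomial (ζ : ℂ) (w : W) (p : ℂ[X]) :
    logShift ζ (logPolynomial w p) = logPolynomial w (taylor ζ p) := by
  have h : logShift ζ ∘ₗ logPolynomial w = logPolynomial w ∘ₗ taylor ζ := by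
    refine Polynomial.lhom_ext' fun k => LinearMap.ext_ring ?_
    simp only [LinearMap.comp_apply]
    rw [logPolynomial_monomial, one_smul, monomial_one_right_eq_X_pow, taylor_X_pow, add_pow,
      map_sum, logShift, Finsupp.lsum_single, LinearMap.sum_apply]
    refine Finset.sum_congr rfl fun j _ => ?_
    rw [mul_assoc, ← C_pow, ← C_eq_natCast, ← C_mul, mul_comm (X ^ j), C_mul_X_pow_eq_monomial,
      logPolynomial_monomial]
    simp [mul_comm]
  exact LinearMap.congr_fun h p

theorem logDeriv_logPolynomial (w : W) (p : ℂ[X]) :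
    logDeriv (logPolynomial w p) = logPolynomial w (derivative p) := by
  have h : logDeriv ∘ₗ logPolynomial w = logPolynomial w ∘ₗ derivative := by
    refine Polynomial.lhom_ext' fun k => LinearMap.ext_ring ?_
    simp [logPolynomial_monomial, derivative_monomial, logDeriv]
  exact LinearMap.congr_fun h p

theorem logShift_neg_logShift (ζ : ℂ) (g : ℕ →₀ W) : logShift (-ζ) (logShift ζ g) = g := by
  induction g using Finsupp.induction_linear with
  | zero => simp
  | add f g hf hg => rw [map_add, map_add, hf, hg]
  | single k w =>
    rw [← logPolynomial_X_pow, logShift_logPolynomial, logShift_logPolynomial, taylor_taylor,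
      neg_add_cancel, taylor_zero]

theorem logShift_logDeriv (ζ : ℂ) (g : ℕ →₀ W) :
    logShift ζ (logDeriv g) = logDeriv (logShift ζ g) := by
  induction g using Finsupp.induction_linear with
  | zero => simp
  | add f g hf hg => simp only [map_add, hf, hg]
  | single k w =>
    rw [← logPolynomial_X_pow, logDeriv_logPolynomial, logShift_logPolynomial,
      logShift_logPolynomial, logDeriv_logPolynomial]
    congr 1
    rw [taylor_apply, taylor_apply, derivative_comp]
    simp

theorem coeffwise_logShift (ζ : ℂ) (T : Module.End ℂ W) (g : ℕ →₀ W) :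
    coeffwise T (logShift ζ g) = logShift ζ (coeffwise T g) := by
  induction g using Finsupp.induction_linear with
  | zero => simp
  | add f g hf hg => simp only [map_add, hf, hg]
  | single k w => simp [logShift, coeffwise, Finsupp.mapRange_single]

theorem coeffwise_logDeriv (T : Module.End ℂ W) (g : ℕ →₀ W) :
    coeffwise T (logDeriv g) = logDeriv (coeffwise T g) := by
  ext k
  simp [logDeriv_apply]

theorem logShift_mem {S : Submodule ℂ W} (ζ : ℂ) {g : ℕ →₀ W} (hg : ∀ k, g k ∈ S) (k : ℕ) :
    logShift ζ g k ∈ S := by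
  rw [logShift, Finsupp.lsum_apply, Finsupp.sum, Finsupp.finsetSum_apply]
  refine Submodule.sum_mem _ fun j _ => ?_
  rw [LinearMap.sum_apply, Finsupp.finsetSum_apply]
  refine Submodule.sum_mem _ fun i _ => ?_
  rw [LinearMap.smul_apply, Finsupp.smul_apply, Finsupp.lsingle_apply, Finsupp.single_apply]
  split_ifs
  · exact S.smul_mem _ (hg j)
  · exact S.smul_mem _ S.zero_mem

end LogPolynomial

/-! ## The operators `L(-1)`, `L(0)`, `L(1)` on generalized modules -/

section Modules

variable {V W : Type*} [AddCommGroup V] [Module ℂ V] [AddCommGroup W] [Module ℂ W]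

/-- The factor `m³ - m` vanishes for `m = -1, 0, 1`, so the central charge does not enter. -/
theorem VirasoroRelations.isRepresentation {L : ℤ → Module.End ℂ W} {c : ℂ}
    (h : VirasoroRelations L c) : (⟨L (-1), L 0, L 1⟩ : SL2Operators W).IsRepresentation where
  zero_neg := by simpa using h 0 (-1)
  zero_pos := by simpa using h 0 1
  neg_pos := by
    have h := h (-1) 1
    norm_num at h
    exact h.trans (neg_smul _ _).symm

/-- At `l = m = 0` the binomials `(0 choose i)` leave only `i = 0` in each sum. For `u = ω` this
yields the commutator with `L(-1) = ω_0`. -/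
theorem JacobiIdentity.commutator {Y : V →ₗ[ℂ] V →ₗ[ℂ] (ℤ → V)} {Y' : V →ₗ[ℂ] W →ₗ[ℂ] (ℤ → W)}
    (h : JacobiIdentity Y Y' Y' (fun v w n => Y' v w n)) (u v : V) (w : W) (n : ℤ) :
    Y' u (Y' v w n) 0 - Y' v (Y' u w 0) n = Y' (Y u v 0) w n := by
  have key : ∀ {c : ℕ → ℤ} {g : ℕ → W}, (∀ i ≠ 0, c i = 0) → c 0 = 1 →
      ∑ᶠ i, c i • g i = g 0 := fun hc hc0 => by
    rw [finsum_eq_single _ 0 fun i hi => by rw [hc i hi, zero_smul], hc0, one_smul]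
  have hz : ∀ i : ℕ, i ≠ 0 → Ring.choose (0 : ℤ) i = 0 := fun i hi =>
    Ring.choose_zero_pos ℤ (Nat.pos_of_ne_zero hi)
  have := h u v w 0 0 n
  rw [jacobiFirst, jacobiSecond, jacobiThird,
    key (fun i hi => by rw [hz i hi, mul_zero]) (by simp),
    key (fun i hi => by rw [hz i hi, mul_zero]) (by simp),
    key (fun i hi => hz i hi) (by simp)] at this
  simpa using this

namespace VertexAlgebra.GeneralizedModule

variable {𝒱 : VertexAlgebra V}

theorem isRepresentation (M : 𝒱.GeneralizedModule W) : M.L.IsRepresentation := by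
  cases 𝒱 with
  | mobius 𝒱 => exact MobiusVertexAlgebra.GeneralizedModule.isRepresentation M
  | conformal 𝒱 => exact (ConformalVertexAlgebra.GeneralizedModule.virasoro M).isRepresentation

/-- In the Möbius case the commutator with `L(-1)` is an axiom; in the conformal case it comes from
the Jacobi identity for `ω`. The derivative property then finishes both. -/
theorem L_neg_commutator (M : 𝒱.GeneralizedModule W) (v : V) (w : W) (n : ℤ) :
    M.L.neg (M.Y v w n) - M.Y v (M.L.neg w) n = (-n : ℂ) • M.Y v w (n - 1) := by
  cases 𝒱 with
  | mobius 𝒱 =>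
    exact ((MobiusVertexAlgebra.GeneralizedModule.bracket M).neg v w n).trans
      (MobiusVertexAlgebra.GeneralizedModule.derivative M v w n)
  | conformal 𝒱 =>
    exact ((ConformalVertexAlgebra.GeneralizedModule.toVertexModule M).jacobi.commutator
      𝒱.ω v w n).trans (ConformalVertexAlgebra.GeneralizedModule.derivative M v w n)

theorem component_mul_L_neg (M : 𝒱.GeneralizedModule W) (v : V) (p : ℤ) :
    component M.Y v p * M.L.neg
      = M.L.neg * component M.Y v p + (p : ℂ) • component M.Y v (p - 1) := by
  ext w
  have h := M.L_neg_commutator v w p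
  rw [sub_eq_iff_eq_add, neg_smul] at h
  change M.Y v (M.L.neg w) p = M.L.neg (M.Y v w p) + (p : ℂ) • M.Y v w (p - 1)
  rw [h]
  abel

end VertexAlgebra.GeneralizedModule

end Modules

/-! ## Derivatives and `𝔰𝔩(2)`-operators applied to `e^(xT) f(x)` -/

section ExpSeries

variable {F : Type*} [AddCommGroup F] [Module ℂ F]

/-- The product rule for `x d/dx` on powers of `x`, which multiplies the coefficient of `x^n` by
`n`: the factor `e^(xT)` contributes `xT e^(xT)`. -/
theorem smul_expSeries (T : Module.End ℂ F) {f : ℂ → F} (hf : IsTruncated f) (n : ℂ) :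
    n • expSeries T f n
      = expSeries T (fun x => x • f x) n + expSeries T (fun x => T (f x)) (n - 1) := by
  obtain ⟨N, hN⟩ := hf n
  -- The extra index in the first two sums leaves room to split off `i = 0`; the remaining indices
  -- `i + 1` match the sum containing `T`.
  rw [expSeries_eq_sum T (N := N + 1) fun i hi => hN i (by omega),
    expSeries_eq_sum T (f := fun x => x • f x) (N := N + 1) fun i hi => by
      simp only [hN i (by omega), smul_zero],
    expSeries_eq_sum T (f := fun x => T (f x)) (N := N) fun i hi => by
      have h := hN (i + 1) (by omega)
      rw [Nat.cast_succ, add_comm, ← sub_sub] at h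
      simp only [h, map_zero],
    Finset.smul_sum, Finset.sum_range_succ', Finset.sum_range_succ', add_right_comm,
    ← Finset.sum_add_distrib]
  congr 1
  · refine Finset.sum_congr rfl fun i _ => ?_
    have h := LinearMap.congr_fun (succ_smul_dividedPower_succ T i) (f (n - 1 - i))
    change _ = dividedPower T i (T _) at h
    rw [← h, LinearMap.smul_apply, map_smul, Nat.cast_succ, add_comm (i : ℂ) 1, sub_sub,
      ← add_smul, sub_add_cancel]
  · simp

theorem IsTruncated.id_smul {f : ℂ → F} (hf : IsTruncated f) : IsTruncated fun x => x • f x :=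
  hf.smul_fun fun x => x

/-- The iterated commutators are `Z, T, 0, …`, so the expansion stops at first order: `Z e^(xT) =
e^(xT) (Z + xT)`. -/
theorem apply_expSeries_of_commutator_eq {T Z : Module.End ℂ F} (hZ : Z * T = T * Z + T)
    {f : ℂ → F} (hf : IsTruncated f) (n : ℂ) :
    Z (expSeries T f n)
      = expSeries T (fun x => Z (f x)) n + expSeries T (fun x => T (f x)) (n - 1) := by
  obtain ⟨N, hN⟩ := hf n
  have h := apply_expSeries T (fun s => match s with | 0 => Z | 1 => T | _ + 2 => 0)
    (fun s => by rcases s with _ | _ | s <;> simp [hZ]) (f := f) (n := n) (N := N + 2)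
    fun i hi => hN i (by omega)
  rw [Finset.sum_range_succ', Finset.sum_range_succ', Finset.sum_eq_zero fun i _ => by
    simp [expSeries]] at h
  simpa [add_comm] using h

/-- Here the divided commutators are `P, 2Z, T, 0, …`, so `P e^(xT) = e^(xT) (P + 2xZ + x²T)`. -/
theorem apply_expSeries_of_commutator_eq_two_smul {T Z P : Module.End ℂ F}
    (hZ : Z * T = T * Z + T) (hP : P * T = T * P + (2 : ℂ) • Z) {f : ℂ → F}
    (hf : IsTruncated f) (n : ℂ) :
    P (expSeries T f n)
      = expSeries T (fun x => P (f x)) n + (2 : ℂ) • expSeries T (fun x => Z (f x)) (n - 1)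
        + expSeries T (fun x => T (f x)) (n - 2) := by
  obtain ⟨N, hN⟩ := hf n
  have h := apply_expSeries T
    (fun s => match s with | 0 => P | 1 => (2 : ℂ) • Z | 2 => T | _ + 3 => 0)
    (fun s => by
      rcases s with _ | _ | _ | s
      · simp [hP]
      · simp only [smul_mul_assoc, hZ, mul_smul_comm, smul_add]
        norm_num
      · simp
      · simp) (f := f) (n := n) (N := N + 3) fun i hi => hN i (by omega)
  rw [Finset.sum_range_succ', Finset.sum_range_succ', Finset.sum_range_succ',
    Finset.sum_eq_zero fun i _ => by simp [expSeries]] at h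
  simp only [LinearMap.smul_apply, expSeries_smul] at h
  rw [h]
  norm_num
  abel

end ExpSeries

/-! ### The derivative and the substitution `x ↦ e^ζ x` on logarithmic series -/

section LogSeries

variable {W : Type*} [AddCommGroup W] [Module ℂ W]

/-- The derivative `(d/dx) f`. -/
def seriesDeriv (f : LogSeries W) : LogSeries W := fun n =>
  (n + 1) • f (n + 1) + logDeriv (f (n + 1))

theorem seriesDeriv_apply (f : LogSeries W) (n : ℂ) (k : ℕ) :
    seriesDeriv f n k = derivCoeff f n k := by
  simp [seriesDeriv, derivCoeff, logDeriv_apply]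

/-- The derivative splits into a part acting on powers of `x`, treated by `smul_expSeries`, and a
part acting on `log x`, which commutes with `e^(xT)`. -/
theorem seriesDeriv_expSeries (T : Module.End ℂ W) {f : LogSeries W} (hf : IsTruncated f) (n : ℂ) :
    seriesDeriv (expSeries (coeffwise T) f) n
      = expSeries (coeffwise T) (seriesDeriv f) n
        + expSeries (coeffwise T) (fun x => coeffwise T (f x)) n := by
  have hc : Commute (logDeriv (W := W)) (coeffwise T) :=
    LinearMap.ext fun g => (coeffwise_logDeriv T g).symm
  have h := expSeries_add (coeffwise T) (hf.id_smul.shift (-1)) ((hf.map logDeriv).shift (-1)) n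
  rw [expSeries_shift _ (fun x => x • f x), expSeries_shift _ (fun x => logDeriv (f x)),
    expSeries_map _ _ hc hf] at h
  simp only [sub_neg_eq_add] at h
  rw [seriesDeriv, smul_expSeries _ hf, add_sub_cancel_right, add_right_comm, ← h]
  rfl

theorem IsTruncated.substExp {f : LogSeries W} (hf : IsTruncated f) (ζ : ℂ) :
    IsTruncated (substExp ζ f) :=
  LowerTruncated.map hf ζ

theorem substExp_neg_substExp (ζ : ℂ) (f : LogSeries W) :
    substExp (-ζ) (substExp ζ f) = f := by
  funext n
  rw [substExp_apply, substExp_apply, map_smul, logShift_neg_logShift, smul_smul,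
    ← Complex.exp_add, neg_mul, neg_add_cancel, Complex.exp_zero, one_smul]

/-- Integer steps in the exponent produce only signs; the choice of the logarithm `ζ` of `-1`
affects only the common factor `e^(ζ n)`. -/
theorem exp_mul_add_int {ζ : ℂ} (hζ : Complex.exp ζ = -1) (n : ℂ) (k : ℤ) :
    Complex.exp (ζ * (n + k)) = (k.negOnePow : ℤ) * Complex.exp (ζ * n) := by
  rw [mul_add, Complex.exp_add, mul_comm ζ k, Complex.exp_int_mul, hζ, mul_comm,
    Int.cast_negOnePow]

theorem substExp_add_int {ζ : ℂ} (hζ : Complex.exp ζ = -1) (f : LogSeries W) (n : ℂ) (k : ℤ) :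
    substExp ζ f (n + k)
      = (k.negOnePow : ℤ) • (Complex.exp (ζ * n) • logShift ζ) (f (n + k)) := by
  rw [substExp_apply, exp_mul_add_int hζ, ← smul_smul, Int.cast_smul_eq_zsmul]
  rfl

theorem substExp_map (ζ : ℂ) (T : Module.End ℂ W) (f : LogSeries W) (n : ℂ) :
    substExp ζ (fun x => coeffwise T (f x)) n = coeffwise T (substExp ζ f n) := by
  rw [substExp_apply, substExp_apply, map_smul, coeffwise_logShift]

theorem substExp_shift_nat {ζ : ℂ} (hζ : Complex.exp ζ = -1) (f : LogSeries W) (i : ℕ) (n : ℂ) :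
    substExp ζ (fun x => f (x - i)) n = (-1 : ℂ) ^ i • substExp ζ f (n - i) := by
  have h : Complex.exp (ζ * (n - i)) = (-1) ^ i * Complex.exp (ζ * n) := by
    simpa [sub_eq_add_neg] using exp_mul_add_int hζ n (-i)
  rw [substExp_apply, substExp_apply, h, smul_smul, ← mul_assoc, ← mul_pow]
  norm_num

theorem substExp_seriesDeriv {ζ : ℂ} (hζ : Complex.exp ζ = -1) (f : LogSeries W) (n : ℂ) :
    substExp ζ (seriesDeriv f) n = -seriesDeriv (substExp ζ f) n := by
  have h : Complex.exp (ζ * (n + 1)) = -Complex.exp (ζ * n) := by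
    simpa using exp_mul_add_int hζ n 1
  rw [seriesDeriv, substExp_apply, substExp_apply, h, seriesDeriv, map_add, map_smul, map_smul,
    logShift_logDeriv]
  module

theorem substExp_expSeries {ζ : ℂ} (hζ : Complex.exp ζ = -1) (T : Module.End ℂ W)
    {f : LogSeries W} (hf : IsTruncated f) :
    substExp ζ (expSeries (coeffwise T) f) = expSeries (-coeffwise T) (substExp ζ f) := by
  funext n
  obtain ⟨N, hN⟩ := hf n
  rw [substExp_apply, expSeries_eq_sum _ hN, expSeries_eq_sum (N := N) _ fun i hi => by
    rw [substExp_apply, hN i hi, map_zero, smul_zero], map_sum, Finset.smul_sum]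
  refine Finset.sum_congr rfl fun i _ => ?_
  have h : Complex.exp (ζ * (n - i)) = (-1) ^ i * Complex.exp (ζ * n) := by
    simpa [sub_eq_add_neg] using exp_mul_add_int hζ n (-i)
  have hc : logShift ζ (dividedPower (coeffwise T) i (f (n - i)))
      = dividedPower (coeffwise T) i (logShift ζ (f (n - i))) := by
    rw [dividedPower, ← coeffwise_pow, LinearMap.smul_apply, LinearMap.smul_apply, map_smul,
      coeffwise_logShift]
  have hs : dividedPower (-coeffwise T) i = (-1 : ℂ) ^ i • dividedPower (coeffwise T) i := by
    rw [dividedPower, dividedPower, smul_comm, ← neg_one_smul ℂ (coeffwise T), smul_pow]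
  rw [hc, substExp_apply, h, hs, map_smul, LinearMap.smul_apply, smul_smul, mul_right_comm,
    ← mul_pow]
  norm_num

end LogSeries

/-! ## Intertwining operators in terms of formal series -/

section Intertwining

variable {V W₁ W₂ W₃ : Type*} [AddCommGroup V] [Module ℂ V]
  [AddCommGroup W₁] [Module ℂ W₁] [AddCommGroup W₂] [Module ℂ W₂] [AddCommGroup W₃] [Module ℂ W₃]
  {𝒱 : VertexAlgebra V}

theorem isTruncated (𝒴 : TruncatedMap W₁ W₂ W₃) (w₁ : W₁) (w₂ : W₂) : IsTruncated (𝒴.1 w₁ w₂) :=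
  𝒴.2 w₁ w₂

theorem series_first_bound (M₃ : 𝒱.GeneralizedModule W₃) (𝒴 : TruncatedMap W₁ W₂ W₃)
    (v : V) (w₁ : W₁) (w₂ : W₂) (c : ℕ → ℤ) (l : ℤ) (n : ℂ) :
    ∃ N : ℕ, ∀ i : ℕ, N ≤ i →
      c i • coeffwise (component M₃.Y v (l - i)) (𝒴.1 w₁ w₂ (n - i)) = 0 := by
  obtain ⟨N, hN⟩ := 𝒴.2 w₁ w₂ n
  exact ⟨N, fun i hi => by rw [hN i hi, map_zero, smul_zero]⟩

theorem series_second_bound (M₂ : 𝒱.GeneralizedModule W₂) (𝒴 : TruncatedMap W₁ W₂ W₃)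
    (v : V) (w₁ : W₁) (w₂ : W₂) (c : ℕ → ℤ) (m : ℤ) (n : ℂ) :
    ∃ N : ℕ, ∀ i : ℕ, N ≤ i → c i • 𝒴.1 w₁ (M₂.Y v w₂ (m + i)) (n + i) = 0 := by
  obtain ⟨N, hN⟩ := nat_bound (M₂.truncation v w₂) m
  exact ⟨N, fun i hi => by rw [hN i hi, map_zero, Pi.zero_apply, smul_zero]⟩

theorem series_third_bound (M₁ : 𝒱.GeneralizedModule W₁) (𝒴 : TruncatedMap W₁ W₂ W₃)
    (v : V) (w₁ : W₁) (w₂ : W₂) (c : ℕ → ℤ) (l : ℤ) (n : ℂ) :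
    ∃ N : ℕ, ∀ i : ℕ, N ≤ i → c i • 𝒴.1 (M₁.Y v w₁ (l + i)) w₂ (n + i) = 0 := by
  obtain ⟨N, hN⟩ := nat_bound (M₁.truncation v w₁) l
  exact ⟨N, fun i hi => by
    rw [hN i hi, map_zero, LinearMap.zero_apply, Pi.zero_apply, smul_zero]⟩

theorem map_finsum_of_bound {M N : Type*} [AddCommGroup M] [Module ℂ M] [AddCommGroup N]
    [Module ℂ N] (S : M →ₗ[ℂ] N) {g : ℕ → M} (h : ∃ N : ℕ, ∀ i : ℕ, N ≤ i → g i = 0) :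
    S (∑ᶠ i, g i) = ∑ᶠ i, S (g i) :=
  S.toAddMonoidHom.map_finsum (finite_support_of_bound h)

/-- The Jacobi identity for the series `𝒴(w₁, x) w₂` with coefficients in `W₃[log x]`. -/
def SeriesJacobi (M₁ : 𝒱.GeneralizedModule W₁) (M₂ : 𝒱.GeneralizedModule W₂)
    (M₃ : 𝒱.GeneralizedModule W₃) (𝒴 : TruncatedMap W₁ W₂ W₃) : Prop :=
  ∀ (v : V) (w₁ : W₁) (w₂ : W₂) (l m : ℤ) (n : ℂ),
    ∑ᶠ i : ℕ, ((-1) ^ i * Ring.choose l i : ℤ) •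
        coeffwise (component M₃.Y v (l + m - i)) (𝒴.1 w₁ w₂ (n - i))
      - ∑ᶠ i : ℕ, ((l.negOnePow : ℤ) * (-1) ^ i * Ring.choose l i : ℤ) •
        𝒴.1 w₁ (M₂.Y v w₂ (m + i)) (n - l + i)
    = ∑ᶠ i : ℕ, (Ring.choose m i : ℤ) • 𝒴.1 (M₁.Y v w₁ (l + i)) w₂ (n - m + i)

/-- The identity involves each power of `log x` separately, whereas the shift of `log x` mixes them.
Passing to coefficients in `W₃[log x]` lets the shift act on all powers at once; the index `n` of a
mode becomes the exponent `-n - 1`. -/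
theorem jacobi_iff_seriesJacobi (M₁ : 𝒱.GeneralizedModule W₁) (M₂ : 𝒱.GeneralizedModule W₂)
    (M₃ : 𝒱.GeneralizedModule W₃) (𝒴 : TruncatedMap W₁ W₂ W₃) :
    (∀ k, JacobiIdentity M₁.Y M₂.Y M₃.Y (mode 𝒴.1 k)) ↔ SeriesJacobi M₁ M₂ M₃ 𝒴 := by
  have key : ∀ (k : ℕ) (v : V) (w₁ : W₁) (w₂ : W₂) (l m : ℤ) (n : ℂ),
      (∑ᶠ i : ℕ, ((-1) ^ i * Ring.choose l i : ℤ) •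
        coeffwise (component M₃.Y v (l + m - i)) (𝒴.1 w₁ w₂ (n - i))) k
        = jacobiFirst M₃.Y (mode 𝒴.1 k) v w₁ w₂ l m (-n - 1) ∧
      (∑ᶠ i : ℕ, ((l.negOnePow : ℤ) * (-1) ^ i * Ring.choose l i : ℤ) •
        𝒴.1 w₁ (M₂.Y v w₂ (m + i)) (n - l + i)) k
        = jacobiSecond M₂.Y (mode 𝒴.1 k) v w₁ w₂ l m (-n - 1) ∧
      (∑ᶠ i : ℕ, (Ring.choose m i : ℤ) • 𝒴.1 (M₁.Y v w₁ (l + i)) w₂ (n - m + i)) k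
        = jacobiThird M₁.Y (mode 𝒴.1 k) v w₁ w₂ l m (-n - 1) := by
    intro k v w₁ w₂ l m n
    refine ⟨(map_finsum_of_bound (Finsupp.lapply k) (series_first_bound M₃ 𝒴 v w₁ w₂ _ _ _)).trans
        (finsum_congr fun i => ?_),
      (map_finsum_of_bound (Finsupp.lapply k) (series_second_bound M₂ 𝒴 v w₁ w₂ _ _ _)).trans
        (finsum_congr fun i => ?_),
      (map_finsum_of_bound (Finsupp.lapply k) (series_third_bound M₁ 𝒴 v w₁ w₂ _ _ _)).trans
        (finsum_congr fun i => ?_)⟩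
    · rw [mode, show -(-n - 1 + (i : ℂ)) - 1 = n - i by ring]
      rfl
    · rw [mode, show -(-n - 1 + (l : ℂ) - i) - 1 = n - l + i by ring]
      rfl
    · rw [mode, show -((m : ℂ) + (-n - 1) - i) - 1 = n - m + i by ring]
      rfl
  constructor
  · intro h v w₁ w₂ l m n
    ext k
    obtain ⟨h₁, h₂, h₃⟩ := key k v w₁ w₂ l m n
    rw [Finsupp.sub_apply, h₁, h₂, h₃]
    exact h k v w₁ w₂ l m _
  · intro h k v w₁ w₂ l m n
    obtain ⟨h₁, h₂, h₃⟩ := key k v w₁ w₂ l m (-n - 1)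
    rw [show -(-n - 1) - 1 = n by ring] at h₁ h₂ h₃
    rw [← h₁, ← h₂, ← h₃, ← Finsupp.sub_apply, h]

/-- The `𝔰𝔩(2)`-bracket relations for the series `𝒴(w₁, x) w₂` with coefficients in
`W₃[log x]`. -/
structure SeriesBracket (L₁ : SL2Operators W₁) (L₂ : SL2Operators W₂) (L₃ : SL2Operators W₃)
    (𝒴 : TruncatedMap W₁ W₂ W₃) : Prop where
  neg : ∀ w₁ w₂ n, coeffwise L₃.neg (𝒴.1 w₁ w₂ n)
    = 𝒴.1 w₁ (L₂.neg w₂) n + 𝒴.1 (L₁.neg w₁) w₂ n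
  zero : ∀ w₁ w₂ n, coeffwise L₃.zero (𝒴.1 w₁ w₂ n)
    = 𝒴.1 w₁ (L₂.zero w₂) n + 𝒴.1 (L₁.zero w₁) w₂ n + 𝒴.1 (L₁.neg w₁) w₂ (n - 1)
  pos : ∀ w₁ w₂ n, coeffwise L₃.pos (𝒴.1 w₁ w₂ n)
    = 𝒴.1 w₁ (L₂.pos w₂) n + 𝒴.1 (L₁.pos w₁) w₂ n
      + (2 : ℂ) • 𝒴.1 (L₁.zero w₁) w₂ (n - 1) + 𝒴.1 (L₁.neg w₁) w₂ (n - 2)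

theorem bracket_iff_seriesBracket (L₁ : SL2Operators W₁) (L₂ : SL2Operators W₂)
    (L₃ : SL2Operators W₃) (𝒴 : TruncatedMap W₁ W₂ W₃) :
    (∀ k, SL2BracketRelations L₁ L₂ L₃ (mode 𝒴.1 k)) ↔ SeriesBracket L₁ L₂ L₃ 𝒴 := by
  have e₁ : ∀ n : ℂ, -(n + 1) - 1 = -n - 1 - 1 := fun n => by ring
  have e₂ : ∀ n : ℂ, -(n + 2) - 1 = -n - 1 - 2 := fun n => by ring
  have e₃ : ∀ n : ℂ, -(-n - 1) - 1 = n := fun n => by ring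
  constructor
  · intro h
    refine ⟨fun w₁ w₂ n => Finsupp.ext fun k => ?_, fun w₁ w₂ n => Finsupp.ext fun k => ?_,
      fun w₁ w₂ n => Finsupp.ext fun k => ?_⟩
    · have := (h k).neg w₁ w₂ (-n - 1)
      simp only [mode, e₃, sub_eq_iff_eq_add'] at this
      simpa using this
    · have := (h k).zero w₁ w₂ (-n - 1)
      simp only [mode, e₁, e₃, sub_eq_iff_eq_add'] at this
      simpa [add_assoc] using this
    · have := (h k).pos w₁ w₂ (-n - 1)
      simp only [mode, e₁, e₂, e₃, sub_eq_iff_eq_add'] at this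
      simpa [add_assoc] using this
  · intro h k
    refine ⟨fun w₁ w₂ n => ?_, fun w₁ w₂ n => ?_, fun w₁ w₂ n => ?_⟩
    · have := DFunLike.congr_fun (h.neg w₁ w₂ (-n - 1)) k
      simp only [mode, sub_eq_iff_eq_add']
      simpa using this
    · have := DFunLike.congr_fun (h.zero w₁ w₂ (-n - 1)) k
      simp only [mode, e₁, sub_eq_iff_eq_add']
      simpa [add_assoc] using this
    · have := DFunLike.congr_fun (h.pos w₁ w₂ (-n - 1)) k
      simp only [mode, e₁, e₂, sub_eq_iff_eq_add']
      simpa [add_assoc] using this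

/-! ## The operators `Ω_r` -/

theorem Omega_apply (M₃ : 𝒱.GeneralizedModule W₃) (r : ℤ) (𝒴 : TruncatedMap W₁ W₂ W₃)
    (w₂ : W₂) (w₁ : W₁) :
    (Omega M₃ r 𝒴).1 w₂ w₁ = expSeries (coeffwise M₃.L.neg)
      (substExp ((2 * r + 1) * Real.pi * Complex.I) (𝒴.1 w₁ w₂)) :=
  expMul_eq_expSeries _ _

theorem exp_odd_mul_pi_mul_I (r : ℤ) :
    Complex.exp ((2 * r + 1) * Real.pi * Complex.I) = -1 := by
  rw [show (2 * r + 1) * Real.pi * Complex.I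
    = Real.pi * Complex.I + r * (2 * Real.pi * Complex.I) by ring, Complex.exp_periodic.int_mul,
    Complex.exp_pi_mul_I]

/-- The condition on `r` and `s` says that the two values of `ζ` are opposite. Being symmetric in
`r` and `s`, it covers both compositions. -/
theorem Omega_Omega (M₃ : 𝒱.GeneralizedModule W₃) {r s : ℤ} (h : r + s = -1)
    (𝒴 : TruncatedMap W₁ W₂ W₃) : Omega M₃ s (Omega M₃ r 𝒴) = 𝒴 := by
  refine Subtype.ext (LinearMap.ext fun w₁ => LinearMap.ext fun w₂ => ?_)
  have hs : ((2 * s + 1) * Real.pi * Complex.I : ℂ) = -((2 * r + 1) * Real.pi * Complex.I) := by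
    have : (s : ℂ) = -1 - r := by
      rw [← eq_sub_iff_add_eq'] at h
      rw [h]
      push_cast
      ring
    rw [this]
    ring
  rw [Omega_apply, Omega_apply, substExp_expSeries (exp_odd_mul_pi_mul_I s) _
    ((isTruncated 𝒴 w₁ w₂).substExp _), hs, substExp_neg_substExp]
  exact funext fun n => expSeries_expSeries_neg _ (isTruncated 𝒴 w₁ w₂) n

theorem Omega_add (M₃ : 𝒱.GeneralizedModule W₃) (r : ℤ) (𝒴 𝒵 : TruncatedMap W₁ W₂ W₃) :
    Omega M₃ r (𝒴 + 𝒵) = Omega M₃ r 𝒴 + Omega M₃ r 𝒵 := by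
  refine Subtype.ext (LinearMap.ext fun w₂ => LinearMap.ext fun w₁ => ?_)
  exact (congr_arg (expMul _) (map_add _ _ _)).trans
    (expMul_add _ ((𝒴.2 w₁ w₂).map _) ((𝒵.2 w₁ w₂).map _))

theorem Omega_smul (M₃ : 𝒱.GeneralizedModule W₃) (r : ℤ) (a : ℂ) (𝒴 : TruncatedMap W₁ W₂ W₃) :
    Omega M₃ r (a • 𝒴) = a • Omega M₃ r 𝒴 := by
  refine Subtype.ext (LinearMap.ext fun w₂ => LinearMap.ext fun w₁ => ?_)
  change expMul _ (substExp _ (a • 𝒴.1 w₁ w₂)) = a • expMul _ (substExp _ (𝒴.1 w₁ w₂))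
  rw [map_smul, expMul_smul]

theorem coeffwise_component_mul (M : 𝒱.GeneralizedModule W₃) (v : V) (p : ℤ) :
    coeffwise (component M.Y v p) * coeffwise M.L.neg
      = coeffwise M.L.neg * coeffwise (component M.Y v p)
        + (p : ℂ) • coeffwise (component M.Y v (p - 1)) := by
  rw [← coeffwise_mul, M.component_mul_L_neg, coeffwise_add, coeffwise_mul, coeffwise_smul]

theorem negOnePow_mul_self (l : ℤ) : (l.negOnePow : ℤ) * l.negOnePow = 1 := by
  rw [← Units.val_mul, ← Int.negOnePow_add, ← two_mul, Int.negOnePow_two_mul, Units.val_one]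

theorem SeriesJacobi.Omega {M₁ : 𝒱.GeneralizedModule W₁} {M₂ : 𝒱.GeneralizedModule W₂}
    {M₃ : 𝒱.GeneralizedModule W₃} {𝒴 : TruncatedMap W₁ W₂ W₃} (h : SeriesJacobi M₁ M₂ M₃ 𝒴)
    (r : ℤ) : SeriesJacobi M₂ M₁ M₃ (Omega M₃ r 𝒴) := by
  intro v w₂ w₁ l m n
  have hζ := exp_odd_mul_pi_mul_I r
  set ζ : ℂ := (2 * r + 1) * Real.pi * Complex.I with hζ'
  simp only [Omega_apply, ← hζ']
  refine jacobi_expSeries (coeffwise M₃.L.neg) (fun p => coeffwise (component M₃.Y v p))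
    (coeffwise_component_mul M₃ v) ((isTruncated 𝒴 w₁ w₂).substExp ζ)
    (p := fun i => substExp ζ (𝒴.1 (M₁.Y v w₁ i) w₂))
    (q := fun i => substExp ζ (𝒴.1 w₁ (M₂.Y v w₂ i)))
    (fun i => (isTruncated 𝒴 _ _).substExp ζ) (fun i => (isTruncated 𝒴 _ _).substExp ζ)
    ?_ ?_ ?_ l m n
  · obtain ⟨N, hN⟩ := M₁.truncation v w₁
    exact ⟨N, fun i hi => by rw [hN i hi, map_zero, LinearMap.zero_apply, map_zero]⟩
  · obtain ⟨N, hN⟩ := M₂.truncation v w₂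
    exact ⟨N, fun i hi => by rw [hN i hi, map_zero, map_zero]⟩
  intro l m n
  -- `Q` is the part of the substitution shared by all exponents in `n + ℤ`. The required identity
  -- is `Q` applied to the Jacobi identity for `𝒴`, with the leftover signs absorbed into the
  -- binomial coefficients.
  set Q : Module.End ℂ (ℕ →₀ W₃) := Complex.exp (ζ * n) • logShift ζ with hQ
  have hQc : ∀ (T : Module.End ℂ W₃) g, Q (coeffwise T g) = coeffwise T (Q g) := fun T g => by
    rw [hQ, LinearMap.smul_apply, LinearMap.smul_apply, map_smul, coeffwise_logShift]
  have hnat : ∀ i : ℕ, (((i : ℤ).negOnePow : ℤˣ) : ℤ) = (-1) ^ i := fun i => by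
    simp [Int.negOnePow_def]
  have s₁ : ∀ (f : LogSeries W₃) (i : ℕ),
      substExp ζ f (n - i) = ((-1) ^ i : ℤ) • Q (f (n - i)) := fun f i => by
    have := substExp_add_int hζ f n (-(i : ℤ))
    rwa [Int.negOnePow_neg, hnat, Int.cast_neg, Int.cast_natCast, ← sub_eq_add_neg] at this
  have s₂ : ∀ (f : LogSeries W₃) (l : ℤ) (i : ℕ), substExp ζ f (n - l + i)
      = ((l.negOnePow : ℤ) * (-1) ^ i) • Q (f (n - l + i)) := fun f l i => by
    have := substExp_add_int hζ f n (i - l)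
    rwa [Int.negOnePow_sub, Units.val_mul, hnat, mul_comm, Int.cast_sub, Int.cast_natCast,
      ← add_sub_assoc, add_sub_right_comm] at this
  have hJ := congr_arg Q (h v w₁ w₂ l m n)
  rw [map_sub, map_finsum_of_bound Q (series_first_bound M₃ 𝒴 v w₁ w₂ _ _ _),
    map_finsum_of_bound Q (series_second_bound M₂ 𝒴 v w₁ w₂ _ _ _),
    map_finsum_of_bound Q (series_third_bound M₁ 𝒴 v w₁ w₂ _ _ _)] at hJ
  refine Eq.trans (congr_arg₂ _ (finsum_congr fun i => ?_) (finsum_congr fun i => ?_))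
    (hJ.trans (finsum_congr fun i => ?_))
  · rw [s₁, map_zsmul, map_zsmul, hQc, smul_smul, mul_comm]
  · rw [s₂, map_zsmul, smul_smul, mul_comm]
  · rw [s₂, map_zsmul, smul_smul]
    congr 1
    have h₁ := negOnePow_mul_self m
    have h₂ : ((-1) ^ i * (-1) ^ i : ℤ) = 1 := by rw [← mul_pow]; norm_num
    linear_combination (-Ring.choose m i : ℤ) * ((-1) ^ i * (-1) ^ i) * h₁
      - (Ring.choose m i : ℤ) * h₂

theorem SeriesBracket.Omega {M₁ : 𝒱.GeneralizedModule W₁} {M₂ : 𝒱.GeneralizedModule W₂}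
    {M₃ : 𝒱.GeneralizedModule W₃} {𝒴 : TruncatedMap W₁ W₂ W₃}
    (h : SeriesBracket M₁.L M₂.L M₃.L 𝒴) (r : ℤ) :
    SeriesBracket M₂.L M₁.L M₃.L (Omega M₃ r 𝒴) := by
  have hζ := exp_odd_mul_pi_mul_I r
  set ζ : ℂ := (2 * r + 1) * Real.pi * Complex.I with hζ'
  set T := coeffwise M₃.L.neg with hT
  have ht : ∀ w₁ w₂, IsTruncated (substExp ζ (𝒴.1 w₁ w₂)) := fun w₁ w₂ =>
    (isTruncated 𝒴 w₁ w₂).substExp ζ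
  have hrep := M₃.isRepresentation
  have hZ : coeffwise M₃.L.zero * T = T * coeffwise M₃.L.zero + T := by
    rw [hT, ← coeffwise_mul, ← coeffwise_mul, ← coeffwise_add]
    congr 1
    rw [add_comm, ← sub_eq_iff_eq_add]
    exact hrep.zero_neg
  have hP : coeffwise M₃.L.pos * T = T * coeffwise M₃.L.pos + (2 : ℂ) • coeffwise M₃.L.zero := by
    rw [hT, ← coeffwise_mul, ← coeffwise_mul, ← coeffwise_smul, ← coeffwise_add]
    congr 1
    have := hrep.neg_pos
    rw [sub_eq_iff_eq_add] at this
    rw [this]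
    module
  have hneg : ∀ w₁ w₂ n, T (substExp ζ (𝒴.1 w₁ w₂) n)
      = substExp ζ (𝒴.1 w₁ (M₂.L.neg w₂)) n + substExp ζ (𝒴.1 (M₁.L.neg w₁) w₂) n := by
    intro w₁ w₂ n
    rw [← substExp_map, ← Pi.add_apply, ← map_add]
    exact congr_fun (congr_arg _ (funext fun x => h.neg w₁ w₂ x)) n
  have hzero : ∀ w₁ w₂ n, coeffwise M₃.L.zero (substExp ζ (𝒴.1 w₁ w₂) n)
      = substExp ζ (𝒴.1 w₁ (M₂.L.zero w₂)) n + substExp ζ (𝒴.1 (M₁.L.zero w₁) w₂) n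
        - substExp ζ (𝒴.1 (M₁.L.neg w₁) w₂) (n - 1) := by
    intro w₁ w₂ n
    have e := substExp_shift_nat hζ (𝒴.1 (M₁.L.neg w₁) w₂) 1 n
    rw [Nat.cast_one, pow_one, neg_one_smul] at e
    rw [← substExp_map, sub_eq_add_neg, ← e, ← Pi.add_apply, ← map_add, ← Pi.add_apply, ← map_add]
    exact congr_fun (congr_arg _ (funext fun x => h.zero w₁ w₂ x)) n
  have hpos : ∀ w₁ w₂ n, coeffwise M₃.L.pos (substExp ζ (𝒴.1 w₁ w₂) n)
      = substExp ζ (𝒴.1 w₁ (M₂.L.pos w₂)) n + substExp ζ (𝒴.1 (M₁.L.pos w₁) w₂) n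
        - (2 : ℂ) • substExp ζ (𝒴.1 (M₁.L.zero w₁) w₂) (n - 1)
        + substExp ζ (𝒴.1 (M₁.L.neg w₁) w₂) (n - 2) := by
    intro w₁ w₂ n
    have e₁ := substExp_shift_nat hζ (𝒴.1 (M₁.L.zero w₁) w₂) 1 n
    have e₂ := substExp_shift_nat hζ (𝒴.1 (M₁.L.neg w₁) w₂) 2 n
    rw [Nat.cast_one, pow_one, neg_one_smul] at e₁
    rw [Nat.cast_ofNat, neg_one_sq, one_smul] at e₂
    rw [← substExp_map, sub_eq_add_neg, ← smul_neg, ← e₁, ← e₂, ← Pi.smul_apply, ← map_smul,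
      ← Pi.add_apply, ← map_add, ← Pi.add_apply, ← map_add, ← Pi.add_apply, ← map_add]
    exact congr_fun (congr_arg _ (funext fun x => h.pos w₁ w₂ x)) n
  have eT : ∀ w₁ w₂ n, expSeries T (fun x => T (substExp ζ (𝒴.1 w₁ w₂) x)) n
      = expSeries T (substExp ζ (𝒴.1 w₁ (M₂.L.neg w₂))) n
        + expSeries T (substExp ζ (𝒴.1 (M₁.L.neg w₁) w₂)) n := fun w₁ w₂ n => by
    simp only [hneg]
    exact expSeries_add T (ht _ _) (ht _ _) n
  have eZ : ∀ w₁ w₂ n, expSeries T (fun x => coeffwise M₃.L.zero (substExp ζ (𝒴.1 w₁ w₂) x)) n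
      = expSeries T (substExp ζ (𝒴.1 w₁ (M₂.L.zero w₂))) n
        + expSeries T (substExp ζ (𝒴.1 (M₁.L.zero w₁) w₂)) n
        - expSeries T (substExp ζ (𝒴.1 (M₁.L.neg w₁) w₂)) (n - 1) := fun w₁ w₂ n => by
    simp only [hzero]
    rw [expSeries_sub T ((ht _ _).add (ht _ _)) ((ht _ _).shift 1),
      expSeries_add T (ht _ _) (ht _ _), expSeries_shift]
  have eP : ∀ w₁ w₂ n, expSeries T (fun x => coeffwise M₃.L.pos (substExp ζ (𝒴.1 w₁ w₂) x)) n
      = expSeries T (substExp ζ (𝒴.1 w₁ (M₂.L.pos w₂))) n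
        + expSeries T (substExp ζ (𝒴.1 (M₁.L.pos w₁) w₂)) n
        - (2 : ℂ) • expSeries T (substExp ζ (𝒴.1 (M₁.L.zero w₁) w₂)) (n - 1)
        + expSeries T (substExp ζ (𝒴.1 (M₁.L.neg w₁) w₂)) (n - 2) := fun w₁ w₂ n => by
    simp only [hpos]
    rw [expSeries_add T (((ht _ _).add (ht _ _)).sub (((ht _ _).shift 1).smul (2 : ℂ)))
      ((ht _ _).shift 2), expSeries_sub T ((ht _ _).add (ht _ _)) (((ht _ _).shift 1).smul (2 : ℂ)),
      expSeries_add T (ht _ _) (ht _ _), expSeries_smul, expSeries_shift, expSeries_shift]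
  -- Of the terms where an operator acts on `w₁`, only the one in which `L(j)` itself acts survives.
  -- For `j = 1`, those with `L(0) w₁` have coefficients `-2 + 2`, and those with `L(-1) w₁` have `1
  -- - 2 + 1`.
  refine ⟨fun w₂ w₁ n => ?_, fun w₂ w₁ n => ?_, fun w₂ w₁ n => ?_⟩
  · simp only [Omega_apply, ← hζ', ← hT]
    rw [← expSeries_map T T (Commute.refl T) (ht w₁ w₂), eT, add_comm]
  · simp only [Omega_apply, ← hζ', ← hT]
    rw [apply_expSeries_of_commutator_eq hZ (ht w₁ w₂), eT, eZ]
    abel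
  · simp only [Omega_apply, ← hζ', ← hT]
    rw [apply_expSeries_of_commutator_eq_two_smul hZ hP (ht w₁ w₂), eT, eZ, eP, sub_sub n,
      one_add_one_eq_two]
    module

theorem IsLogIntertwiningOperator.Omega {M₁ : 𝒱.GeneralizedModule W₁}
    {M₂ : 𝒱.GeneralizedModule W₂} {M₃ : 𝒱.GeneralizedModule W₃} {𝒴 : TruncatedMap W₁ W₂ W₃}
    (h : IsLogIntertwiningOperator M₁ M₂ M₃ 𝒴) (r : ℤ) :
    IsLogIntertwiningOperator M₂ M₁ M₃ (Omega M₃ r 𝒴) where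
  jacobi := (jacobi_iff_seriesJacobi _ _ _ _).mpr
    (((jacobi_iff_seriesJacobi _ _ _ _).mp h.jacobi).Omega r)
  bracket := (bracket_iff_seriesBracket _ _ _ _).mpr
    (((bracket_iff_seriesBracket _ _ _ _).mp h.bracket).Omega r)
  derivative w₂ w₁ n k := by
    have hζ := exp_odd_mul_pi_mul_I r
    have ht := (isTruncated 𝒴 w₁ w₂).substExp ((2 * r + 1) * Real.pi * Complex.I)
    have hb := ((bracket_iff_seriesBracket _ _ _ _).mp h.bracket).neg w₁ w₂
    have hd : 𝒴.1 (M₁.L.neg w₁) w₂ = seriesDeriv (𝒴.1 w₁ w₂) :=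
      funext fun x => Finsupp.ext fun j =>
        (h.derivative w₁ w₂ x j).trans (seriesDeriv_apply _ _ _).symm
    rw [← seriesDeriv_apply]
    congr 1
    simp only [Omega_apply]
    set ζ : ℂ := (2 * r + 1) * Real.pi * Complex.I
    -- The `L(-1)`-bracket and the derivative property give `𝒴(w₁, x) L(-1) w₂ = (L(-1) - d/dx)
    -- 𝒴(w₁, x) w₂`. The substitution reverses the sign of `d/dx`, leaving `f' + L(-1) f`, as in the
    -- product rule for `e^(xL(-1)) f`.
    have e : 𝒴.1 w₁ (M₂.L.neg w₂)
        = (fun x => coeffwise M₃.L.neg (𝒴.1 w₁ w₂ x)) - seriesDeriv (𝒴.1 w₁ w₂) := by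
      funext x
      rw [Pi.sub_apply, hb, hd, add_sub_cancel_right]
    have e' : ∀ x, substExp ζ (𝒴.1 w₁ (M₂.L.neg w₂)) x
        = seriesDeriv (substExp ζ (𝒴.1 w₁ w₂)) x
          + coeffwise M₃.L.neg (substExp ζ (𝒴.1 w₁ w₂) x) := fun x => by
      rw [e, map_sub, Pi.sub_apply, substExp_map, substExp_seriesDeriv hζ, sub_neg_eq_add, add_comm]
    have htd : IsTruncated (seriesDeriv (substExp ζ (𝒴.1 w₁ w₂))) := by
      have := (ht.id_smul.add (ht.map logDeriv)).shift (-1)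
      simp only [sub_neg_eq_add] at this
      exact this
    rw [seriesDeriv_expSeries _ ht, ← expSeries_add _ htd (ht.map _)]
    exact congr_fun (congr_arg _ (funext e')) n

/-- Each coefficient of `Ω_r(𝒴)` is a finite combination of powers of `L(-1)` applied to
coefficients of `𝒴` for the same `w₁` and `w₂`. -/
theorem mode_Omega_mem {M₃ : 𝒱.GeneralizedModule W₃} {S : Submodule ℂ W₃}
    (hS : ∀ w ∈ S, M₃.L.neg w ∈ S) {𝒴 : TruncatedMap W₁ W₂ W₃} {w₁ : W₁} {w₂ : W₂}
    (h : ∀ n k, mode 𝒴.1 k w₁ w₂ n ∈ S) (r : ℤ) (n : ℂ) (k : ℕ) :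
    mode (Omega M₃ r 𝒴).1 k w₂ w₁ n ∈ S := by
  obtain ⟨N, hN⟩ := (isTruncated 𝒴 w₁ w₂).substExp ((2 * r + 1) * Real.pi * Complex.I) (-n - 1)
  rw [mode, Omega_apply, expSeries_eq_sum _ hN, Finsupp.finsetSum_apply]
  refine Submodule.sum_mem _ fun i _ => ?_
  rw [dividedPower, ← coeffwise_pow, LinearMap.smul_apply, Finsupp.smul_apply, coeffwise_apply]
  refine S.smul_mem _ ?_
  have hpow : ∀ i : ℕ, ∀ w ∈ S, (M₃.L.neg ^ i) w ∈ S := fun i => by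
    induction i with
    | zero => exact fun w hw => hw
    | succ i ih =>
      intro w hw
      rw [pow_succ]
      exact ih _ (hS w hw)
  refine hpow i _ ?_
  rw [substExp_apply, Finsupp.smul_apply]
  refine S.smul_mem _ (logShift_mem _ (fun j => ?_) k)
  have := h (-(-n - 1 - i) - 1) j
  rwa [mode, show -(-(-n - 1 - i) - 1) - 1 = -n - 1 - (i : ℂ) by ring] at this

/-! ### Grading-compatible operators and the isomorphism given by `Ω_r` -/

section Graded

variable {B : Type*} [AddCommGroup B] {A : AddSubgroup B} {G : 𝒱.StrongGrading A}
  {M₁ : 𝒱.GeneralizedModule W₁} {M₂ : 𝒱.GeneralizedModule W₂} {M₃ : 𝒱.GeneralizedModule W₃}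
  {G₁ : M₁.StrongGrading G} {G₂ : M₂.StrongGrading G} {G₃ : M₃.StrongGrading G}

theorem Omega_mem_gradedLogIntertwiningOperators {𝒴 : TruncatedMap W₁ W₂ W₃}
    (h : 𝒴 ∈ gradedLogIntertwiningOperators G₁ G₂ G₃) (r : ℤ) :
    Omega M₃ r 𝒴 ∈ gradedLogIntertwiningOperators G₂ G₁ G₃ := by
  refine ⟨IsLogIntertwiningOperator.Omega h.1 r, fun β γ w₂ hw₂ w₁ hw₁ n k => ?_⟩
  exact mode_Omega_mem (fun w hw => (G₃.L_mem _ w hw).1)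
    (fun n k => by rw [add_comm]; exact h.2 γ β w₁ hw₁ w₂ hw₂ n k) r n k

variable (G₁ G₂ G₃) in
/-- `Ω_r` as an isomorphism from `𝒱_{W₁ W₂}^{W₃}` to `𝒱_{W₂ W₁}^{W₃}`. -/
def OmegaEquiv (r : ℤ) :
    gradedLogIntertwiningOperators G₁ G₂ G₃ ≃ₗ[ℂ] gradedLogIntertwiningOperators G₂ G₁ G₃ where
  toFun 𝒴 := ⟨Omega M₃ r 𝒴, Omega_mem_gradedLogIntertwiningOperators 𝒴.2 r⟩
  invFun 𝒴 := ⟨Omega M₃ (-r - 1) 𝒴, Omega_mem_gradedLogIntertwiningOperators 𝒴.2 _⟩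
  map_add' _ _ := Subtype.ext (Omega_add _ _ _ _)
  map_smul' _ _ := Subtype.ext (Omega_smul _ _ _ _)
  left_inv _ := Subtype.ext (Omega_Omega _ (by ring) _)
  right_inv _ := Subtype.ext (Omega_Omega _ (by ring) _)

end Graded

end Intertwining

end LogVA

end

open LogVA in
theorem proposition3p44 {V W₁ W₂ W₃ : Type*} [AddCommGroup V] [Module ℂ V]
    [AddCommGroup W₁] [Module ℂ W₁] [AddCommGroup W₂] [Module ℂ W₂] [AddCommGroup W₃] [Module ℂ W₃]
    (𝒱 : VertexAlgebra V) (M₁ : 𝒱.GeneralizedModule W₁) (M₂ : 𝒱.GeneralizedModule W₂)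
    (M₃ : 𝒱.GeneralizedModule W₃) (r : ℤ) :
    (∀ 𝒴 ∈ logIntertwiningOperators M₁ M₂ M₃,
      Omega M₃ r 𝒴 ∈ logIntertwiningOperators M₂ M₁ M₃ ∧
      Omega M₃ (-r - 1) (Omega M₃ r 𝒴) = 𝒴 ∧
      Omega M₃ r (Omega M₃ (-r - 1) 𝒴) = 𝒴) ∧
    ∀ {B : Type*} [AddCommGroup B] {A : AddSubgroup B} (G : 𝒱.StrongGrading A)
      (G₁ : M₁.StrongGrading G) (G₂ : M₂.StrongGrading G) (G₃ : M₃.StrongGrading G),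
      (∀ 𝒴 ∈ gradedLogIntertwiningOperators G₁ G₂ G₃,
        Omega M₃ r 𝒴 ∈ gradedLogIntertwiningOperators G₂ G₁ G₃) ∧
      (∃ e : gradedLogIntertwiningOperators G₁ G₂ G₃ ≃ₗ[ℂ] gradedLogIntertwiningOperators G₂ G₁ G₃,
        ∀ 𝒴, (e 𝒴 : TruncatedMap W₂ W₁ W₃) = Omega M₃ r 𝒴) ∧
      fusionRule G₁ G₂ G₃ = fusionRule G₂ G₁ G₃ := by
  refine ⟨fun 𝒴 h => ⟨IsLogIntertwiningOperator.Omega h r, Omega_Omega M₃ (by ring) 𝒴,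
    Omega_Omega M₃ (by ring) 𝒴⟩, fun G G₁ G₂ G₃ =>
    ⟨fun 𝒴 h => Omega_mem_gradedLogIntertwiningOperators h r,
      ⟨OmegaEquiv G₁ G₂ G₃ r, fun _ => rfl⟩, (OmegaEquiv G₁ G₂ G₃ r).rank_eq⟩⟩
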